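/- Let $d\ge 0$, let $\gamma_d$ be the standard Gaussian measure on $\mathbb{R}^d$, and let $\Phi$ be the standard Gaussian distribution function on $\mathbb{R}$, with inverse $\Phi^{-1}:[0,1]\to[-\infty,\infty]$, where $\Phi^{-1}(0)=-\infty$ and $\Phi^{-1}(1)=\infty$. For $-1<\rho<1$, a $\rho$-correlated $d$-dimensional Gaussian pair is a pair $(z,z')$ of random vectors in $\mathbb{R}^d$ with the same joint law as $(g,\rho g+\sqrt{1-\rho^2}\,h)$, where $g,h$ are independent with law $\gamma_d$. For $\alpha,\beta\in[0,1]$ put $$\Lambda_\rho(\alpha,\beta)=\Pr[w\le\Phi^{-1}(\alpha),\ w'\le\Phi^{-1}(\beta)],$$ where $(w,w')$ is a $\rho$-correlated $1$-dimensional Gaussian pair. A pair of parallel halfspaces means two sets, each of the form $\{x:\langle v,x\rangle\le a\}$ or $\{x:\langle v,x\rangle<a\}$ with $a\in[-\infty,\infty]$ (so $\emptyset$ and $\mathbb{R}^d$ are allowed), with the same normal vector $v\neq0$. Let $-1<\rho<1$ and let $(z,z')$ be a $\rho$-correlated $d$-dimensional Gaussian pair. 1. (Borell's isoperimetric inequality.)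 Let $\alpha,\beta\in[0,1]$. For every $v\ne0$ in $\mathbb{R}^d$ there are parallel halfspaces $H,H'$ with normal vector $v$ and $\gamma_d(H)=\alpha$, $\gamma_d(H')=\beta$, and all parallel halfspaces $H,H'$ with these volumes satisfy $\Pr[z\in H,z'\in H']=\Lambda_\rho(\alpha,\beta)$. Let $A,B\subseteq\mathbb{R}^d$ be $\gamma_d$-measurable with $\gamma_d(A)=\alpha$, $\gamma_d(B)=\beta$. If $0<\rho<1$, then $$\Pr[z\in A,\ z'\in B]\le\Lambda_\rho(\alpha,\beta),$$ and hence $\Pr[z\in A,z'\in B]\le\Pr[z\in H,z'\in H']$ for all parallel halfspaces $H,H'$ with $\gamma_d(H)=\alpha$, $\gamma_d(H')=\beta$. If $-1<\rho<0$, both inequalities are reversed. 2. (Volumes $\tfrac12$.) $\Lambda_\rho(\tfrac12,\tfrac12)=\tfrac12-\tfrac1{2\pi}\arccos\rho$. In particular, if $0<\rho<1$ and $\gamma_d(A)=\gamma_d(B)=\tfrac12$, then $\Pr[z\in A,z'\in B]\le\tfrac12-\tfrac1{2\pi}\arccos\rho$. 3. (Functional version.) Let $f,g:\mathbb{R}^d\to[0,1]$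 be $\gamma_d$-measurable. Then $\Lambda_\rho(f(z),g(z'))$ is integrable, and if $0<\rho<1$, then $$\mathbb{E}[\Lambda_\rho(f(z),g(z'))]\le\Lambda_\rho(\mathbb{E}[f(z)],\mathbb{E}[g(z')]).$$ If $-1<\rho<0$, the inequality is reversed. -/

import Mathlib

open MeasureTheory ProbabilityTheory

noncomputable section

namespace Borell

/-- The space `ℝ^d` with its Euclidean structure. -/
abbrev Space (d : ℕ) : Type := EuclideanSpace ℝ (Fin d)

/-- The standard Gaussian measure `γ_d` on `ℝ^d`. -/
abbrev gaussian (d : ℕ) : Measure (Space d) := stdGaussian (Space d)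

/-- The joint law of `(z, ρ z + √(1 - ρ²) g)`, where `z` and `g` are independent with law `μ`. -/
def correlatedLaw {E : Type*} [AddCommGroup E] [Module ℝ E] [MeasurableSpace E]
    (μ : Measure E) (ρ : ℝ) : Measure (E × E) :=
  (μ.prod μ).map (fun p => (p.1, ρ • p.1 + √(1 - ρ ^ 2) • p.2))

/-- `(z, z')` is a `ρ`-correlated `d`-dimensional Gaussian pair: `z` is standard Gaussian and `z'`
is a `ρ`-correlated Gaussian copy of `z`. -/
def IsCorrelatedGaussianPair {d : ℕ} {Ω : Type*} [MeasurableSpace Ω] (ρ : ℝ)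
    (z z' : Ω → Space d) (P : Measure Ω) : Prop :=
  HasLaw (fun ω => (z ω, z' ω)) (correlatedLaw (gaussian d) ρ) P

/-- The inverse `Φ⁻¹` of the standard Gaussian cdf `Φ`, as a map from `[0,1]` to the extended
reals: the least `x` with `p ≤ Φ x`. The infimum is taken in `[-∞, ∞]`, so that `Φ⁻¹ 0 = -∞` and
`Φ⁻¹ 1 = ∞`. -/
def gaussianQuantile (p : ℝ) : EReal :=
  sInf ((fun x : ℝ => (x : EReal)) '' {x : ℝ | p ≤ cdf (gaussianReal 0 1) x})

/-- `Λ_ρ(α, β) = Pr[w ≤ Φ⁻¹(α), w' ≤ Φ⁻¹(β)]` for a `ρ`-correlated pair `(w, w')` of real standard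
Gaussians. -/
def Lam (ρ α β : ℝ) : ℝ :=
  (correlatedLaw (gaussianReal 0 1) ρ).real
    {w | (w.1 : EReal) ≤ gaussianQuantile α ∧ (w.2 : EReal) ≤ gaussianQuantile β}

/-- `H` is a closed or open halfspace with outer normal `v`. The threshold may be infinite, so the
empty set and the whole space are included as the halfspaces of Gaussian volume `0` and `1`. -/
def IsHalfspace {d : ℕ} (v : Space d) (H : Set (Space d)) : Prop :=
  ∃ a : EReal, H = {x | ((inner ℝ v x : ℝ) : EReal) ≤ a} ∨ H = {x | ((inner ℝ v x : ℝ) : EReal) < a}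

/-- `H` and `H'` are parallel halfspaces: they have a common outer normal. -/
def AreParallelHalfspaces {d : ℕ} (H H' : Set (Space d)) : Prop :=
  ∃ v : Space d, v ≠ 0 ∧ IsHalfspace v H ∧ IsHalfspace v H'

end Borell

end

/-! Everything follows from the functional inequality. For indicator functions it is the inequality
for sets, since Λ_ρ(1,1) = 1 and Λ_ρ(0,·) = Λ_ρ(·,0) = 0.

The reason is a concavity property of Λ = Λ_ρ on the open unit square. In the coordinates x = Φ(a),
y = Φ(b), its second derivatives are multiples of the joint density J of a correlated pair. If the
mixed derivative is multiplied by ρ ≥ 0, the Hessian form becomes the negative square -(ρ/√(1-ρ²)) J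
(p/φ(a) - q/φ(b))² (`hess_nonpos`). That factor ρ is what averaging produces: E[L(z) L'(z')] = ρ
E[L(z) L'(z)] for linear functionals L, L' (`integral_mul_correlatedLaw`). So for a small increment
r(z, z'), a Taylor expansion about the means of F(a + rz) and G(b + rz') has linear terms of mean
zero and a quadratic term of nonpositive mean, and the inequality holds up to O(r³)
(`small_increment_inequality`).

A correlated pair is equal in law to a sum of n independent correlated pairs scaled by r = 1/√n.
Averaging F and G over one increment keeps their bounds, so induction gives a total error n ·
O(n^{-3/2}), which tends to 0 (`increments_inequality`, `smooth_inequality`). This covers smooth F,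
G with values in [δ, 1-δ]. Measurable functions are reached by L¹ approximation, because Λ is
1-Lipschitz in each variable (`abs_Lam_sub_le`, `exists_smooth_approx`, `integral_Lam_le`).

Negative ρ reduces to -ρ by reflecting z' and complementing β: Λ_ρ(α,β) = α - Λ_{-ρ}(α, 1-β).
Parallel halfspaces depend on one coordinate, which turns their joint probability into Λ itself.
Volumes 1/2 give the angle of a planar wedge. -/

namespace Borell

/-! ### Correlated Gaussian pairs: marginals and symmetries. -/

section CorrelatedLaw

/-- The linear map sending independent copies to a correlated pair. -/
noncomputable def correlate (E : Type*) [NormedAddCommGroup E] [NormedSpace ℝ E] (ρ : ℝ) :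
    E × E →L[ℝ] E × E :=
  (ContinuousLinearMap.fst ℝ E E).prod
    (ρ • ContinuousLinearMap.fst ℝ E E + √(1 - ρ ^ 2) • ContinuousLinearMap.snd ℝ E E)

variable {E : Type*} [NormedAddCommGroup E] [NormedSpace ℝ E]

lemma correlate_apply (ρ : ℝ) (p : E × E) :
    correlate E ρ p = (p.1, ρ • p.1 + √(1 - ρ ^ 2) • p.2) := rfl

variable [MeasurableSpace E]

lemma correlatedLaw_eq_map (μ : Measure E) (ρ : ℝ) :
    correlatedLaw μ ρ = (μ.prod μ).map (correlate E ρ) := rfl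

variable [BorelSpace E] [SecondCountableTopology E]

lemma measurePreserving_correlate (μ : Measure E) (ρ : ℝ) :
    MeasurePreserving (correlate E ρ) (μ.prod μ) (correlatedLaw μ ρ) :=
  ⟨(correlate E ρ).continuous.measurable, rfl⟩

instance isProbabilityMeasure_correlatedLaw (μ : Measure E) [IsProbabilityMeasure μ] (ρ : ℝ) :
    IsProbabilityMeasure (correlatedLaw μ ρ) :=
  Measure.isProbabilityMeasure_map (correlate E ρ).continuous.aemeasurable

lemma measurePreserving_fst_correlatedLaw (μ : Measure E) [IsProbabilityMeasure μ] (ρ : ℝ) :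
    MeasurePreserving Prod.fst (correlatedLaw μ ρ) μ := by
  refine ⟨measurable_fst, ?_⟩
  rw [correlatedLaw_eq_map, Measure.map_map measurable_fst (correlate E ρ).continuous.measurable]
  exact (measurePreserving_fst (μ := μ) (ν := μ)).map_eq

variable [CompleteSpace E] {μ : Measure E} [IsGaussian μ]

/-- Rotation invariance of a product of two equal centered Gaussians; the angle is the argument of a
+ bi. -/
lemma measurePreserving_rotate (hμ : μ[id] = 0) {a b : ℝ} (h : a ^ 2 + b ^ 2 = 1) :
    MeasurePreserving (fun p : E × E => (a • p.1 + b • p.2, -b • p.1 + a • p.2))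
      (μ.prod μ) (μ.prod μ) := by
  obtain ⟨θ, ha, hb⟩ : ∃ θ, a = Real.cos θ ∧ b = Real.sin θ := by
    refine ⟨Complex.arg ⟨a, b⟩, ?_, ?_⟩
    · have hn : ‖(⟨a, b⟩ : ℂ)‖ = 1 := by
        rw [Complex.norm_eq_sqrt_sq_add_sq]; simp [h]
      have := Complex.norm_mul_cos_arg ⟨a, b⟩
      rw [hn] at this; simpa using this.symm
    · have hn : ‖(⟨a, b⟩ : ℂ)‖ = 1 := by
        rw [Complex.norm_eq_sqrt_sq_add_sq]; simp [h]
      have := Complex.norm_mul_sin_arg ⟨a, b⟩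
      rw [hn] at this; simpa using this.symm
  refine ⟨by fun_prop, ?_⟩
  have := IsGaussian.map_rotation_eq_self hμ θ
  subst ha hb
  exact this

lemma measurePreserving_smul_add_smul (hμ : μ[id] = 0) {a b : ℝ} (h : a ^ 2 + b ^ 2 = 1) :
    MeasurePreserving (fun p : E × E => a • p.1 + b • p.2) (μ.prod μ) μ :=
  measurePreserving_fst.comp (measurePreserving_rotate hμ h)

lemma measurePreserving_neg_of_centered (hμ : μ[id] = 0) :
    MeasurePreserving (fun x : E => -x) μ μ := by
  have h := measurePreserving_smul_add_smul hμ (a := -1) (b := 0) (by norm_num)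
  refine ⟨by fun_prop, ?_⟩
  have h2 := (measurePreserving_fst (μ := μ) (ν := μ)).map_eq
  rw [← h.map_eq]
  conv_lhs => rw [h.map_eq, ← h2]
  rw [Measure.map_map (by fun_prop) (by fun_prop)]
  congr 1
  ext p; simp

lemma sq_add_sq_sqrt {ρ : ℝ} (hρ : -1 < ρ) (hρ' : ρ < 1) : ρ ^ 2 + √(1 - ρ ^ 2) ^ 2 = 1 := by
  rw [Real.sq_sqrt (by nlinarith)]; ring

lemma measurePreserving_snd_correlatedLaw (hμ : μ[id] = 0) {ρ : ℝ} (hρ : -1 < ρ) (hρ' : ρ < 1) :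
    MeasurePreserving Prod.snd (correlatedLaw μ ρ) μ := by
  refine ⟨measurable_snd, ?_⟩
  rw [correlatedLaw_eq_map, Measure.map_map measurable_snd (correlate E ρ).continuous.measurable]
  exact (measurePreserving_smul_add_smul hμ (sq_add_sq_sqrt hρ hρ')).map_eq

lemma measurePreserving_swap_correlatedLaw (hμ : μ[id] = 0) {ρ : ℝ} (hρ : -1 < ρ) (hρ' : ρ < 1) :
    MeasurePreserving Prod.swap (correlatedLaw μ ρ) (correlatedLaw μ ρ) := by
  have hr := sq_add_sq_sqrt hρ hρ'
  -- This orthogonal reflection of the independent pair exchanges the two components of the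
  -- correlated pair: its first output is the second component, and correlating its outputs recovers
  -- the original first component.
  have h1 : MeasurePreserving
      (fun p : E × E => (ρ • p.1 + √(1 - ρ ^ 2) • p.2, √(1 - ρ ^ 2) • p.1 - ρ • p.2))
      (μ.prod μ) (μ.prod μ) := by
    have := ((MeasurePreserving.id μ).prod (measurePreserving_neg_of_centered hμ)).comp
      (measurePreserving_rotate hμ hr)
    convert this using 2 with p
    ext
    · simp
    · simp [sub_eq_neg_add]
  have h2 := (measurePreserving_correlate μ ρ).comp h1
  refine ⟨measurable_swap, ?_⟩
  conv_lhs => rw [correlatedLaw_eq_map]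
  rw [Measure.map_map measurable_swap (correlate E ρ).continuous.measurable]
  conv_rhs => rw [← h2.map_eq]
  congr 1
  ext p
  · simp [correlate_apply]
  · simp only [Function.comp, correlate_apply, Prod.swap]
    have : p.1 = (ρ ^ 2 + √(1 - ρ ^ 2) ^ 2) • p.1 := by rw [hr, one_smul]
    conv_lhs => rw [this]
    module

lemma measurePreserving_neg_snd_correlatedLaw (hμ : μ[id] = 0) (ρ : ℝ) :
    MeasurePreserving (fun p : E × E => (p.1, -p.2)) (correlatedLaw μ ρ)
      (correlatedLaw μ (-ρ)) := by
  have h1 := (MeasurePreserving.id μ).prod (measurePreserving_neg_of_centered hμ)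
  have h2 := (measurePreserving_correlate μ (-ρ)).comp h1
  refine ⟨by fun_prop, ?_⟩
  rw [← h2.map_eq, correlatedLaw_eq_map,
    Measure.map_map (by fun_prop) (correlate E ρ).continuous.measurable]
  congr 1
  ext p
  · simp [correlate_apply]
  · simp only [Function.comp, correlate_apply, Prod.map, neg_sq, id]
    module

instance isGaussian_correlatedLaw (ρ : ℝ) : IsGaussian (correlatedLaw μ ρ) := by
  rw [correlatedLaw_eq_map]; infer_instance

lemma integral_id_correlatedLaw (hμ : μ[id] = 0) {ρ : ℝ} (hρ : -1 < ρ) (hρ' : ρ < 1) :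
    (correlatedLaw μ ρ)[id] = 0 := by
  have hi : Integrable id (correlatedLaw μ ρ) := IsGaussian.integrable_id
  have h1 := (measurePreserving_fst_correlatedLaw μ ρ)
  have h2 := (measurePreserving_snd_correlatedLaw hμ hρ hρ')
  ext
  · rw [fst_integral hi]
    have := h1.hasLaw.integral_comp (f := id) (by fun_prop)
    simp only [id_eq] at hμ ⊢
    simpa [Function.comp_def, hμ] using this
  · rw [snd_integral hi]
    have := h2.hasLaw.integral_comp (f := id) (by fun_prop)
    simp only [id_eq] at hμ ⊢
    simpa [Function.comp_def, hμ] using this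

end CorrelatedLaw

end Borell

namespace Borell

/-! ### The Gaussian distribution function, its quantiles and half-lines. -/

section Quantile

open Set Filter Topology

/-- The standard Gaussian distribution function. -/
noncomputable def Phi (x : ℝ) : ℝ := cdf (gaussianReal 0 1) x

/-- The standard Gaussian density. -/
noncomputable def phi (x : ℝ) : ℝ := gaussianPDFReal 0 1 x

instance : NullSingletonClass (gaussianReal 0 1) := nullSingletonClass_gaussianReal one_ne_zero

lemma integral_id_gaussianReal_zero_one : (gaussianReal 0 1)[id] = 0 := by simp

lemma phi_eq (x : ℝ) : phi x = (√(2 * Real.pi))⁻¹ * Real.exp (-x ^ 2 / 2) := by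
  simp [phi, gaussianPDFReal]

lemma phi_pos (x : ℝ) : 0 < phi x := gaussianPDFReal_pos _ _ _ one_ne_zero

lemma continuous_phi : Continuous phi := by
  rw [funext phi_eq]; fun_prop

lemma integrable_phi : Integrable phi := integrable_gaussianPDFReal 0 1

lemma Phi_eq_real (x : ℝ) : Phi x = (gaussianReal 0 1).real (Iic x) := cdf_eq_real _ _

lemma Phi_eq_integral (x : ℝ) : Phi x = ∫ t in Iic x, phi t := by
  rw [Phi_eq_real, measureReal_def, gaussianReal_apply_eq_integral _ one_ne_zero,
    ENNReal.toReal_ofReal]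
  · rfl
  · exact integral_nonneg fun _ => gaussianPDFReal_nonneg _ _ _

lemma hasDerivAt_integral_Iic {f : ℝ → ℝ} (hf : Continuous f) (hi : Integrable f) (x : ℝ) :
    HasDerivAt (fun a => ∫ t in Iic a, f t) (f x) x := by
  have h : (fun a => ∫ t in Iic a, f t) =
      fun a => (∫ t in Iic 0, f t) + ∫ t in (0 : ℝ)..a, f t := by
    ext a
    rw [← intervalIntegral.integral_Iic_sub_Iic hi.integrableOn hi.integrableOn]; ring
  rw [h]
  exact (intervalIntegral.integral_hasDerivAt_right hi.intervalIntegrable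
    (hf.stronglyMeasurableAtFilter _ _) hf.continuousAt).const_add _

lemma hasDerivAt_Phi (x : ℝ) : HasDerivAt Phi (phi x) x := by
  rw [funext Phi_eq_integral]
  exact hasDerivAt_integral_Iic continuous_phi integrable_phi x

lemma continuous_Phi : Continuous Phi :=
  continuous_iff_continuousAt.2 fun x => (hasDerivAt_Phi x).continuousAt

lemma strictMono_Phi : StrictMono Phi :=
  strictMono_of_deriv_pos fun x => by rw [(hasDerivAt_Phi x).deriv]; exact phi_pos x

lemma Phi_nonneg (x : ℝ) : 0 ≤ Phi x := cdf_nonneg _ _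

lemma Phi_le_one (x : ℝ) : Phi x ≤ 1 := cdf_le_one _ _

lemma Phi_lt_one (x : ℝ) : Phi x < 1 :=
  (strictMono_Phi (lt_add_one x)).trans_le (Phi_le_one _)

lemma Phi_pos (x : ℝ) : 0 < Phi x :=
  (Phi_nonneg _).trans_lt (strictMono_Phi (sub_one_lt x))

lemma exists_Phi_eq {p : ℝ} (hp : p ∈ Ioo (0 : ℝ) 1) : ∃ x, Phi x = p :=
  mem_range_of_exists_le_of_exists_ge continuous_Phi
    (((tendsto_cdf_atBot (gaussianReal 0 1)).eventually (ge_mem_nhds hp.1)).exists)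
    (((tendsto_cdf_atTop (gaussianReal 0 1)).eventually (le_mem_nhds hp.2)).exists)

lemma gaussianQuantile_Phi (x : ℝ) : gaussianQuantile (Phi x) = x := by
  have : {y : ℝ | Phi x ≤ cdf (gaussianReal 0 1) y} = Ici x := by
    ext y; exact strictMono_Phi.le_iff_le
  rw [gaussianQuantile, this]
  refine IsLeast.csInf_eq ⟨⟨x, self_mem_Ici, rfl⟩, ?_⟩
  rintro _ ⟨y, hy, rfl⟩
  exact EReal.coe_le_coe_iff.2 hy

lemma gaussianQuantile_of_nonpos {p : ℝ} (hp : p ≤ 0) : gaussianQuantile p = ⊥ := by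
  refine eq_bot_iff.2 (EReal.le_of_forall_lt_iff_le.1 fun y _ => ?_)
  exact sInf_le ⟨y, hp.trans (cdf_nonneg _ _), rfl⟩

lemma gaussianQuantile_of_one_le {p : ℝ} (hp : 1 ≤ p) : gaussianQuantile p = ⊤ := by
  have : {x : ℝ | p ≤ cdf (gaussianReal 0 1) x} = ∅ :=
    eq_empty_of_forall_notMem fun x hx => (hp.trans hx).not_gt (Phi_lt_one x)
  simp [gaussianQuantile, this]

/-- The half-line below the `p`-quantile. -/
def lowerTail (p : ℝ) : Set ℝ := {w | (w : EReal) ≤ gaussianQuantile p}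

lemma isLowerSet_lowerTail (p : ℝ) : IsLowerSet (lowerTail p) :=
  fun _ _ h hx => (EReal.coe_le_coe_iff.2 h).trans hx

lemma _root_.IsLowerSet.measurableSet_real {S : Set ℝ} (hS : IsLowerSet S) : MeasurableSet S :=
  hS.ordConnected.measurableSet

lemma lowerTail_of_nonpos {p : ℝ} (hp : p ≤ 0) : lowerTail p = ∅ := by
  simp [lowerTail, gaussianQuantile_of_nonpos hp]

lemma lowerTail_of_one_le {p : ℝ} (hp : 1 ≤ p) : lowerTail p = univ := by
  simp [lowerTail, gaussianQuantile_of_one_le hp]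

lemma lowerTail_Phi (x : ℝ) : lowerTail (Phi x) = Iic x := by
  ext y; simp [lowerTail, gaussianQuantile_Phi]

/-- Clamping makes the formula valid for every real p, so the Lipschitz bounds on `Lam` need no
range restriction. -/
lemma real_lowerTail (p : ℝ) : (gaussianReal 0 1).real (lowerTail p) = max 0 (min p 1) := by
  rcases le_or_gt p 0 with h0 | h0
  · rw [lowerTail_of_nonpos h0, min_eq_left (h0.trans zero_le_one), max_eq_left h0]; simp
  rcases le_or_gt 1 p with h1 | h1
  · rw [lowerTail_of_one_le h1]; simp [h1]
  obtain ⟨x, rfl⟩ := exists_Phi_eq ⟨h0, h1⟩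
  rw [lowerTail_Phi, ← Phi_eq_real, min_eq_left h1.le, max_eq_right h0.le]

lemma real_lowerTail_of_mem {p : ℝ} (hp : p ∈ Icc (0 : ℝ) 1) :
    (gaussianReal 0 1).real (lowerTail p) = p := by
  rw [real_lowerTail, min_eq_left hp.2, max_eq_right hp.1]

/-- Lower sets of a line are nested, so equal finite measure leaves only a null difference. This
treats open, closed and infinite thresholds uniformly. -/
lemma ae_eq_of_isLowerSet {S T : Set ℝ} (hS : IsLowerSet S) (hT : IsLowerSet T)
    (h : (gaussianReal 0 1).real S = (gaussianReal 0 1).real T) : S =ᵐ[gaussianReal 0 1] T := by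
  have h' : gaussianReal 0 1 S = gaussianReal 0 1 T :=
    (measureReal_eq_measureReal_iff).1 h
  rcases hS.total hT with hst | hst
  · exact ae_eq_of_subset_of_measure_ge hst h'.ge hS.measurableSet_real.nullMeasurableSet
      (measure_ne_top _ _)
  · exact (ae_eq_of_subset_of_measure_ge hst h'.le hT.measurableSet_real.nullMeasurableSet
      (measure_ne_top _ _)).symm

end Quantile

/-! ### Elementary properties of Λ: symmetry, Lipschitz continuity, reflection. -/

section LamBasic

open Set Filter Topology

lemma Lam_eq_real_prod (ρ α β : ℝ) :
    Lam ρ α β = (correlatedLaw (gaussianReal 0 1) ρ).real (lowerTail α ×ˢ lowerTail β) := rfl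

variable {ρ : ℝ}

lemma Lam_nonneg (α β : ℝ) : 0 ≤ Lam ρ α β := measureReal_nonneg

lemma Lam_le_one (α β : ℝ) : Lam ρ α β ≤ 1 := measureReal_le_one

lemma prod_ae_eq_prod {E : Type*} [NormedAddCommGroup E] [NormedSpace ℝ E] [MeasurableSpace E]
    [BorelSpace E] [SecondCountableTopology E] [CompleteSpace E] {μ : Measure E} [IsGaussian μ]
    (hμ : μ[id] = 0) (hρ : -1 < ρ) (hρ' : ρ < 1) {S S' T T' : Set E}
    (hS : S =ᵐ[μ] S') (hT : T =ᵐ[μ] T') : S ×ˢ T =ᵐ[correlatedLaw μ ρ] S' ×ˢ T' := by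
  have h1 := (measurePreserving_fst_correlatedLaw μ ρ).quasiMeasurePreserving.preimage_ae_eq hS
  have h2 :=
    (measurePreserving_snd_correlatedLaw hμ hρ hρ').quasiMeasurePreserving.preimage_ae_eq hT
  exact h1.inter h2

lemma real_prod_eq_Lam (hρ : -1 < ρ) (hρ' : ρ < 1) {S T : Set ℝ} (hS : IsLowerSet S)
    (hT : IsLowerSet T) : (correlatedLaw (gaussianReal 0 1) ρ).real (S ×ˢ T) =
      Lam ρ ((gaussianReal 0 1).real S) ((gaussianReal 0 1).real T) := by
  rw [Lam_eq_real_prod]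
  refine measureReal_congr (prod_ae_eq_prod integral_id_gaussianReal_zero_one hρ hρ' ?_ ?_)
  · exact ae_eq_of_isLowerSet hS (isLowerSet_lowerTail _)
      (real_lowerTail_of_mem ⟨measureReal_nonneg, measureReal_le_one⟩).symm
  · exact ae_eq_of_isLowerSet hT (isLowerSet_lowerTail _)
      (real_lowerTail_of_mem ⟨measureReal_nonneg, measureReal_le_one⟩).symm

lemma Lam_comm (hρ : -1 < ρ) (hρ' : ρ < 1) (α β : ℝ) : Lam ρ α β = Lam ρ β α := by
  rw [Lam_eq_real_prod, Lam_eq_real_prod,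
    ← (measurePreserving_swap_correlatedLaw integral_id_gaussianReal_zero_one hρ
      hρ').measureReal_preimage]
  · rw [preimage_swap_prod]
  · exact ((isLowerSet_lowerTail _).measurableSet_real.prod
      (isLowerSet_lowerTail _).measurableSet_real).nullMeasurableSet

/-- Changing the first threshold adds at most a strip, whose probability is read off from the first
marginal. -/
lemma Lam_sub_le (α α' β : ℝ) : Lam ρ α β - Lam ρ α' β ≤ |α - α'| := by
  have hsub : lowerTail α ×ˢ lowerTail β ⊆
      lowerTail α' ×ˢ lowerTail β ∪ Prod.fst ⁻¹' (lowerTail α \ lowerTail α') := by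
    rintro p ⟨h1, h2⟩
    by_cases h : p.1 ∈ lowerTail α'
    · exact Or.inl ⟨h, h2⟩
    · exact Or.inr ⟨h1, h⟩
  have hmS : MeasurableSet (lowerTail α \ lowerTail α') :=
    (isLowerSet_lowerTail _).measurableSet_real.diff (isLowerSet_lowerTail _).measurableSet_real
  have h1 : Lam ρ α β ≤ Lam ρ α' β + (gaussianReal 0 1).real (lowerTail α \ lowerTail α') := by
    rw [Lam_eq_real_prod, Lam_eq_real_prod, ← (measurePreserving_fst_correlatedLaw
      (gaussianReal 0 1) ρ).measureReal_preimage hmS.nullMeasurableSet]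
    exact (measureReal_mono hsub).trans (measureReal_union_le _ _)
  have h2 : (gaussianReal 0 1).real (lowerTail α \ lowerTail α') ≤ |α - α'| := by
    rcases (isLowerSet_lowerTail α).total (isLowerSet_lowerTail α') with h | h
    · rw [sdiff_eq_empty.2 h]; simp
    · rw [measureReal_sdiff h (isLowerSet_lowerTail _).measurableSet_real, real_lowerTail,
        real_lowerTail]
      refine (le_abs_self _).trans ((abs_max_sub_max_le_max _ _ _ _).trans ?_)
      rw [sub_self, abs_zero, max_eq_right (abs_nonneg _)]
      refine (abs_min_sub_min_le_max _ _ _ _).trans ?_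
      rw [sub_self, abs_zero, max_eq_left (abs_nonneg _)]
  linarith

lemma abs_Lam_sub_le (hρ : -1 < ρ) (hρ' : ρ < 1) (α β α' β' : ℝ) :
    |Lam ρ α β - Lam ρ α' β'| ≤ |α - α'| + |β - β'| := by
  have h1 := Lam_sub_le (ρ := ρ) α α' β
  have h2 := Lam_sub_le (ρ := ρ) α' α β
  have h3 := Lam_sub_le (ρ := ρ) β β' α'
  have h4 := Lam_sub_le (ρ := ρ) β' β α'
  rw [Lam_comm hρ hρ' β, Lam_comm hρ hρ' β'] at h3 h4
  rw [abs_sub_comm] at h2 h4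
  rw [abs_le]
  constructor <;> linarith

lemma continuous_Lam (hρ : -1 < ρ) (hρ' : ρ < 1) :
    Continuous (fun p : ℝ × ℝ => Lam ρ p.1 p.2) := by
  refine LipschitzWith.continuous (K := 2) (LipschitzWith.of_dist_le_mul fun p q => ?_)
  rw [Real.dist_eq, Prod.dist_eq, Real.dist_eq, Real.dist_eq]
  refine (abs_Lam_sub_le hρ hρ' _ _ _ _).trans ?_
  have h1 := le_max_left |p.1 - q.1| |p.2 - q.2|
  have h2 := le_max_right |p.1 - q.1| |p.2 - q.2|
  push_cast
  linarith

lemma Lam_zero_left (β : ℝ) : Lam ρ 0 β = 0 := by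
  rw [Lam_eq_real_prod, lowerTail_of_nonpos le_rfl]; simp

lemma Lam_zero_right (α : ℝ) : Lam ρ α 0 = 0 := by
  rw [Lam_eq_real_prod, lowerTail_of_nonpos le_rfl]; simp

lemma Lam_one_one : Lam ρ 1 1 = 1 := by
  rw [Lam_eq_real_prod, lowerTail_of_one_le le_rfl]; simp

/-- Split the event w ≤ Φ⁻¹(α) according to w'. On the complementary part, replacing w' by -w'
changes the correlation to -ρ. This is the bridge to negative correlation. -/
lemma Lam_eq_sub_Lam_neg (hρ : -1 < ρ) (hρ' : ρ < 1) {α β : ℝ} (hα : α ∈ Icc (0 : ℝ) 1)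
    (hβ : β ∈ Icc (0 : ℝ) 1) : Lam ρ α β = α - Lam (-ρ) α (1 - β) := by
  have hS := (isLowerSet_lowerTail α).measurableSet_real
  have hT := (isLowerSet_lowerTail β).measurableSet_real
  -- The complement of a lower half-line is an upper one; reflecting it gives a lower set again, of
  -- measure 1 - β.
  set T' : Set ℝ := (fun x => -x) ⁻¹' (lowerTail β)ᶜ with hT'
  have hlow : IsLowerSet T' := fun a b hab ha hb =>
    ha (isLowerSet_lowerTail β (neg_le_neg hab) hb)
  have hμT : (gaussianReal 0 1).real T' = 1 - β := by
    rw [(measurePreserving_neg_of_centered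
      integral_id_gaussianReal_zero_one).measureReal_preimage hT.compl.nullMeasurableSet,
      probReal_compl_eq_one_sub hT, real_lowerTail_of_mem hβ]
  have h1 : Lam (-ρ) α (1 - β) =
      (correlatedLaw (gaussianReal 0 1) ρ).real (lowerTail α ×ˢ (lowerTail β)ᶜ) := by
    conv_lhs => rw [← hμT, ← real_lowerTail_of_mem hα]
    rw [← real_prod_eq_Lam (by linarith) (by linarith) (isLowerSet_lowerTail α) hlow,
      ← (measurePreserving_neg_snd_correlatedLaw integral_id_gaussianReal_zero_one
        ρ).measureReal_preimage (hS.prod hlow.measurableSet_real).nullMeasurableSet]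
    congr 1
    ext p
    simp [hT']
  have h2 : (correlatedLaw (gaussianReal 0 1) ρ).real (Prod.fst ⁻¹' lowerTail α) = α := by
    rw [(measurePreserving_fst_correlatedLaw (gaussianReal 0 1) ρ).measureReal_preimage
      hS.nullMeasurableSet, real_lowerTail_of_mem hα]
  have h3 : Prod.fst ⁻¹' lowerTail α =
      lowerTail α ×ˢ lowerTail β ∪ lowerTail α ×ˢ (lowerTail β)ᶜ := by
    ext p; by_cases h : p.2 ∈ lowerTail β <;> simp [h]
  rw [h3, measureReal_union _ (hS.prod hT.compl)] at h2
  · rw [h1, Lam_eq_real_prod]; linarith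
  · exact Set.disjoint_left.2 fun p hp hp' => hp'.2 hp.2

end LamBasic

end Borell

namespace Borell

/-! ### Derivatives of Λ and its uniform second-order expansion. -/

section LamDeriv

open Set Filter Topology

variable {ρ : ℝ}

lemma sqrt_one_sub_sq_pos (hρ : -1 < ρ) (hρ' : ρ < 1) : 0 < √(1 - ρ ^ 2) :=
  Real.sqrt_pos.2 (by nlinarith)

/-- Condition on the first coordinate s: the second is then ρs plus an independent Gaussian scaled
by √(1 - ρ²). -/
lemma Lam_Phi_eq_integral (hρ : -1 < ρ) (hρ' : ρ < 1) (a b : ℝ) :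
    Lam ρ (Phi a) (Phi b) = ∫ s in Iic a, phi s * Phi ((b - ρ * s) / √(1 - ρ ^ 2)) := by
  have hσ := sqrt_one_sub_sq_pos hρ hρ'
  set σ := √(1 - ρ ^ 2)
  have hm : MeasurableSet {p : ℝ × ℝ | p.1 ≤ a ∧ ρ * p.1 + σ * p.2 ≤ b} := by
    have m1 : MeasurableSet {p : ℝ × ℝ | p.1 ≤ a} := measurableSet_le (by fun_prop) (by fun_prop)
    have m2 : MeasurableSet {p : ℝ × ℝ | ρ * p.1 + σ * p.2 ≤ b} :=
      measurableSet_le (by fun_prop) (by fun_prop)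
    exact m1.inter m2
  have hInt : Integrable ({p : ℝ × ℝ | p.1 ≤ a ∧ ρ * p.1 + σ * p.2 ≤ b}.indicator (1 : ℝ × ℝ → ℝ))
      ((gaussianReal 0 1).prod (gaussianReal 0 1)) :=
    (integrable_const (1 : ℝ)).indicator hm
  have h1 : Lam ρ (Phi a) (Phi b) = ((gaussianReal 0 1).prod (gaussianReal 0 1)).real
      {p : ℝ × ℝ | p.1 ≤ a ∧ ρ * p.1 + σ * p.2 ≤ b} := by
    rw [Lam_eq_real_prod, lowerTail_Phi, lowerTail_Phi, ← (measurePreserving_correlate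
      (gaussianReal 0 1) ρ).measureReal_preimage
      (measurableSet_Iic.prod measurableSet_Iic).nullMeasurableSet]
    rfl
  rw [h1, ← integral_indicator_one hm, integral_prod _ hInt]
  have h2 : ∀ x : ℝ, ∫ y, ({p : ℝ × ℝ | p.1 ≤ a ∧ ρ * p.1 + σ * p.2 ≤ b}.indicator 1 (x, y) : ℝ)
      ∂gaussianReal 0 1 = (Iic a).indicator (fun s => Phi ((b - ρ * s) / σ)) x := by
    intro x
    by_cases hx : x ≤ a
    · rw [indicator_of_mem (mem_Iic.2 hx), Phi_eq_real, ← integral_indicator_one measurableSet_Iic]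
      congr 1
      ext y
      have : (x, y) ∈ {p : ℝ × ℝ | p.1 ≤ a ∧ ρ * p.1 + σ * p.2 ≤ b} ↔
          y ∈ Iic ((b - ρ * x) / σ) := by
        simp only [mem_ofPred_eq, hx, true_and, mem_Iic, le_div_iff₀ hσ]
        constructor <;> intro h <;> linarith
      by_cases hy : y ∈ Iic ((b - ρ * x) / σ)
      · rw [indicator_of_mem hy, indicator_of_mem (this.2 hy)]; rfl
      · rw [indicator_of_notMem hy, indicator_of_notMem (fun h => hy (this.1 h))]
    · rw [indicator_of_notMem (by simpa using hx)]
      have : ∀ y, ({p : ℝ × ℝ | p.1 ≤ a ∧ ρ * p.1 + σ * p.2 ≤ b}.indicator 1 (x, y) : ℝ) = 0 :=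
        fun y => indicator_of_notMem (fun h => hx h.1) _
      simp [this]
  simp_rw [h2]
  rw [integral_gaussianReal_eq_integral_smul one_ne_zero, ← integral_indicator measurableSet_Iic]
  congr 1
  ext x
  by_cases hx : x ∈ Iic a
  · simp only [indicator_of_mem hx, smul_eq_mul]; rfl
  · simp [indicator_of_notMem hx]

lemma hasDerivAt_Lam_Phi (hρ : -1 < ρ) (hρ' : ρ < 1) (a b : ℝ) :
    HasDerivAt (fun s => Lam ρ (Phi s) (Phi b))
      (phi a * Phi ((b - ρ * a) / √(1 - ρ ^ 2))) a := by
  simp_rw [Lam_Phi_eq_integral hρ hρ']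
  have hc : Continuous fun s => Phi ((b - ρ * s) / √(1 - ρ ^ 2)) :=
    continuous_Phi.comp (by fun_prop)
  refine hasDerivAt_integral_Iic (continuous_phi.mul hc) ?_ a
  refine integrable_phi.mul_bdd (c := 1) hc.aestronglyMeasurable (ae_of_all _ fun x => ?_)
  rw [Real.norm_eq_abs, abs_of_nonneg (Phi_nonneg _)]
  exact Phi_le_one _

/-- The real-valued Gaussian quantile function. -/
noncomputable def quantile (x : ℝ) : ℝ := (gaussianQuantile x).toReal

lemma quantile_Phi (a : ℝ) : quantile (Phi a) = a := by
  rw [quantile, gaussianQuantile_Phi, EReal.toReal_coe]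

lemma Phi_quantile {x : ℝ} (hx : x ∈ Ioo (0 : ℝ) 1) : Phi (quantile x) = x := by
  obtain ⟨a, rfl⟩ := exists_Phi_eq hx
  rw [quantile_Phi]

lemma Phi_mem_Ioo (a : ℝ) : Phi a ∈ Ioo (0 : ℝ) 1 := ⟨Phi_pos a, Phi_lt_one a⟩

lemma strictMonoOn_quantile : StrictMonoOn quantile (Ioo 0 1) := by
  intro x hx y hy hxy
  rw [← strictMono_Phi.lt_iff_lt, Phi_quantile hx, Phi_quantile hy]
  exact hxy

lemma continuousAt_quantile {x : ℝ} (hx : x ∈ Ioo (0 : ℝ) 1) : ContinuousAt quantile x := by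
  refine strictMonoOn_quantile.continuousAt_of_image_mem_nhds (isOpen_Ioo.mem_nhds hx) ?_
  have : quantile '' Ioo 0 1 = univ :=
    eq_univ_of_forall fun a => ⟨Phi a, Phi_mem_Ioo a, quantile_Phi a⟩
  rw [this]; exact univ_mem

lemma hasDerivAt_quantile {x : ℝ} (hx : x ∈ Ioo (0 : ℝ) 1) :
    HasDerivAt quantile (phi (quantile x))⁻¹ x :=
  HasDerivAt.of_local_left_inverse (continuousAt_quantile hx) (hasDerivAt_Phi _) (phi_pos _).ne'
    (eventually_of_mem (isOpen_Ioo.mem_nhds hx) fun _ hy => Phi_quantile hy)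

/-- The first partial derivative of `Lam ρ`. -/
noncomputable def LamFst (ρ x y : ℝ) : ℝ :=
  Phi ((quantile y - ρ * quantile x) / √(1 - ρ ^ 2))

/-- The density from differentiating in a = Φ⁻¹(x) cancels against the derivative 1/φ(a) of the
quantile, leaving a conditional probability. -/
lemma hasDerivAt_Lam_left (hρ : -1 < ρ) (hρ' : ρ < 1) {x y : ℝ} (hx : x ∈ Ioo (0 : ℝ) 1)
    (hy : y ∈ Ioo (0 : ℝ) 1) : HasDerivAt (fun s => Lam ρ s y) (LamFst ρ x y) x := by
  have h := (hasDerivAt_Lam_Phi hρ hρ' (quantile x) (quantile y)).comp x (hasDerivAt_quantile hx)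
  rw [mul_comm, ← mul_assoc, inv_mul_cancel₀ (phi_pos _).ne', one_mul] at h
  refine h.congr_of_eventuallyEq (eventually_of_mem (isOpen_Ioo.mem_nhds hx) fun s hs => ?_)
  simp [Function.comp, Phi_quantile hs, Phi_quantile hy]

lemma hasDerivAt_Lam_right (hρ : -1 < ρ) (hρ' : ρ < 1) {x y : ℝ} (hx : x ∈ Ioo (0 : ℝ) 1)
    (hy : y ∈ Ioo (0 : ℝ) 1) : HasDerivAt (fun s => Lam ρ x s) (LamFst ρ y x) y := by
  simp_rw [fun s => Lam_comm hρ hρ' x s]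
  exact hasDerivAt_Lam_left hρ hρ' hy hx

lemma continuousAt_LamFst {p : ℝ × ℝ} (hx : p.1 ∈ Ioo (0 : ℝ) 1) (hy : p.2 ∈ Ioo (0 : ℝ) 1) :
    ContinuousAt (fun p : ℝ × ℝ => LamFst ρ p.1 p.2) p := by
  have h1 : ContinuousAt (fun p : ℝ × ℝ => quantile p.1) p :=
    (continuousAt_quantile hx).comp continuousAt_fst
  have h2 : ContinuousAt (fun p : ℝ × ℝ => quantile p.2) p :=
    (continuousAt_quantile hy).comp continuousAt_snd
  exact continuous_Phi.continuousAt.comp ((h2.sub (continuousAt_const.mul h1)).div_const _)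

lemma hasFDerivAt_Lam (hρ : -1 < ρ) (hρ' : ρ < 1) {p : ℝ × ℝ} (hx : p.1 ∈ Ioo (0 : ℝ) 1)
    (hy : p.2 ∈ Ioo (0 : ℝ) 1) :
    HasFDerivAt (fun p : ℝ × ℝ => Lam ρ p.1 p.2)
      ((ContinuousLinearMap.toSpanSingleton ℝ (LamFst ρ p.1 p.2)).coprod
        (ContinuousLinearMap.toSpanSingleton ℝ (LamFst ρ p.2 p.1))) p := by
  have hev : ∀ᶠ v : ℝ × ℝ in 𝓝 p, v.1 ∈ Ioo (0 : ℝ) 1 ∧ v.2 ∈ Ioo (0 : ℝ) 1 :=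
    (continuous_fst.continuousAt.eventually (isOpen_Ioo.mem_nhds hx)).and
      (continuous_snd.continuousAt.eventually (isOpen_Ioo.mem_nhds hy))
  have hsw : ContinuousAt (fun p : ℝ × ℝ => LamFst ρ p.2 p.1) p :=
    ContinuousAt.comp (g := fun p : ℝ × ℝ => LamFst ρ p.1 p.2) (f := Prod.swap)
      (continuousAt_LamFst hy hx) continuous_swap.continuousAt
  have hL : Continuous fun c : ℝ => ContinuousLinearMap.toSpanSingleton ℝ c :=
    (ContinuousLinearMap.toSpanSingletonLE ℝ ℝ ℝ).toLinearMap.continuous_of_finiteDimensional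
  exact (hasStrictFDerivAt_uncurry_coprod (f := fun x y => Lam ρ x y)
    (f₁ := fun x y => ContinuousLinearMap.toSpanSingleton ℝ (LamFst ρ x y))
    (f₂ := fun x y => ContinuousLinearMap.toSpanSingleton ℝ (LamFst ρ y x))
    (hev.mono fun v hv => (hasDerivAt_Lam_left hρ hρ' hv.1 hv.2).hasFDerivAt)
    (hev.mono fun v hv => (hasDerivAt_Lam_right hρ hρ' hv.1 hv.2).hasFDerivAt)
    (hL.continuousAt.comp (continuousAt_LamFst hx hy))
    (hL.continuousAt.comp hsw)).hasFDerivAt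

/-- The joint density of a correlated Gaussian pair, up to the factor `√(1 - ρ²)`. -/
noncomputable def jointDensity (ρ a b : ℝ) : ℝ := phi ((b - ρ * a) / √(1 - ρ ^ 2)) * phi a

lemma jointDensity_pos (a b : ℝ) : 0 < jointDensity ρ a b := mul_pos (phi_pos _) (phi_pos _)

/-- Both exponents equal -(a² - 2ρab + b²)/(2(1 - ρ²)). -/
lemma jointDensity_comm (hρ : -1 < ρ) (hρ' : ρ < 1) (a b : ℝ) :
    jointDensity ρ a b = jointDensity ρ b a := by
  have hσ := sqrt_one_sub_sq_pos hρ hρ'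
  have hσ2 : √(1 - ρ ^ 2) ^ 2 = 1 - ρ ^ 2 := Real.sq_sqrt (by nlinarith)
  have h0 : 1 - ρ ^ 2 ≠ 0 := by nlinarith
  simp only [jointDensity, phi_eq]
  rw [mul_mul_mul_comm, mul_mul_mul_comm _ (Real.exp _) _ (Real.exp (-b ^ 2 / 2)), ← Real.exp_add,
    ← Real.exp_add,
    div_pow, div_pow, hσ2]
  congr 2
  field_simp
  ring

/-- The second derivative of `Lam ρ` in its first variable, in quantile coordinates. -/
noncomputable def hessDiag (ρ : ℝ) (p : ℝ × ℝ) : ℝ :=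
  -(ρ / √(1 - ρ ^ 2)) * (jointDensity ρ p.1 p.2 * ((phi p.1)⁻¹ * (phi p.1)⁻¹))

/-- The mixed second derivative of `Lam ρ`, in quantile coordinates. -/
noncomputable def hessMixed (ρ : ℝ) (p : ℝ × ℝ) : ℝ :=
  (√(1 - ρ ^ 2))⁻¹ * (jointDensity ρ p.1 p.2 * ((phi p.1)⁻¹ * (phi p.2)⁻¹))

lemma hasDerivAt_LamFst_line {x y X Y t : ℝ} (hx : x + t * X ∈ Ioo (0 : ℝ) 1)
    (hy : y + t * Y ∈ Ioo (0 : ℝ) 1) :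
    HasDerivAt (fun t => LamFst ρ (x + t * X) (y + t * Y))
      (hessDiag ρ (quantile (x + t * X), quantile (y + t * Y)) * X +
        hessMixed ρ (quantile (x + t * X), quantile (y + t * Y)) * Y) t := by
  have hX : HasDerivAt (fun t => x + t * X) X t := by
    simpa using ((hasDerivAt_id t).mul_const X).const_add x
  have hY : HasDerivAt (fun t => y + t * Y) Y t := by
    simpa using ((hasDerivAt_id t).mul_const Y).const_add y
  have h1 := (hasDerivAt_quantile hx).comp t hX
  have h2 := (hasDerivAt_quantile hy).comp t hY
  have h3 := (hasDerivAt_Phi _).comp t ((h2.sub (h1.const_mul ρ)).div_const (√(1 - ρ ^ 2)))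
  refine h3.congr_deriv ?_
  simp only [hessDiag, hessMixed, jointDensity, Function.comp, Pi.sub_apply]
  have := (phi_pos (quantile (x + t * X))).ne'
  field_simp
  ring

/-- The heart of the argument: after the mixed derivative is multiplied by ρ, the form is a
nonpositive multiple of a perfect square. -/
lemma hess_nonpos (hρ0 : 0 ≤ ρ) (hρ : -1 < ρ) (hρ' : ρ < 1) (a b p q : ℝ) :
    hessDiag ρ (a, b) * p ^ 2 + 2 * (ρ * hessMixed ρ (a, b)) * (p * q)
      + hessDiag ρ (b, a) * q ^ 2 ≤ 0 := by
  have hσ := sqrt_one_sub_sq_pos hρ hρ'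
  have : hessDiag ρ (a, b) * p ^ 2 + 2 * (ρ * hessMixed ρ (a, b)) * (p * q)
      + hessDiag ρ (b, a) * q ^ 2 = -(ρ / √(1 - ρ ^ 2) * jointDensity ρ a b *
        (p * (phi a)⁻¹ - q * (phi b)⁻¹) ^ 2) := by
    simp only [hessDiag, hessMixed, jointDensity_comm hρ hρ' b a]
    ring
  rw [this, neg_nonpos]
  have := jointDensity_pos (ρ := ρ) a b
  positivity

lemma contDiff_phi : ContDiff ℝ 1 phi := by
  rw [funext phi_eq]; fun_prop

lemma contDiff_hessDiag : ContDiff ℝ 1 (hessDiag ρ) := by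
  have h1 : ContDiff ℝ 1 fun p : ℝ × ℝ => phi ((p.2 - ρ * p.1) / √(1 - ρ ^ 2)) :=
    contDiff_phi.comp (by fun_prop)
  have h2 : ContDiff ℝ 1 fun p : ℝ × ℝ => phi p.1 := contDiff_phi.comp contDiff_fst
  have h3 := h2.inv fun p => (phi_pos _).ne'
  exact contDiff_const.mul ((h1.mul h2).mul (h3.mul h3))

lemma contDiff_hessMixed : ContDiff ℝ 1 (hessMixed ρ) := by
  have h1 : ContDiff ℝ 1 fun p : ℝ × ℝ => phi ((p.2 - ρ * p.1) / √(1 - ρ ^ 2)) :=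
    contDiff_phi.comp (by fun_prop)
  have h2 : ContDiff ℝ 1 fun p : ℝ × ℝ => phi p.1 := contDiff_phi.comp contDiff_fst
  have h3 := h2.inv fun p => (phi_pos _).ne'
  have h4 : ContDiff ℝ 1 fun p : ℝ × ℝ => phi p.2 := contDiff_phi.comp contDiff_snd
  have h5 := h4.inv fun p => (phi_pos _).ne'
  exact contDiff_const.mul ((h1.mul h2).mul (h3.mul h5))

/-- The quantile maps [δ, 1-δ] to a compact set and is Lipschitz there, its derivative 1/φ being
bounded. Applied to the Hessian entries, this bounds the Taylor remainder; it is why values must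
stay away from 0 and 1. -/
lemma exists_lipschitz_comp_quantile {f : ℝ × ℝ → ℝ} (hf : ContDiff ℝ 1 f) {δ : ℝ} (hδ : 0 < δ) :
    ∃ M, 0 ≤ M ∧ ∀ x ∈ Icc δ (1 - δ), ∀ y ∈ Icc δ (1 - δ),
      |f (quantile x, quantile y)| ≤ M ∧
      ∀ x' ∈ Icc δ (1 - δ), ∀ y' ∈ Icc δ (1 - δ),
        |f (quantile x', quantile y') - f (quantile x, quantile y)| ≤
          M * (|x' - x| + |y' - y|) := by
  have hsub : Icc δ (1 - δ) ⊆ Ioo (0 : ℝ) 1 := fun x hx => ⟨by linarith [hx.1], by linarith [hx.2]⟩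
  have hcq : ContinuousOn quantile (Icc δ (1 - δ)) := fun x hx =>
    (continuousAt_quantile (hsub hx)).continuousWithinAt
  set S := quantile '' Icc δ (1 - δ)
  have hS : IsCompact S := isCompact_Icc.image_of_continuousOn hcq
  obtain ⟨K, hK⟩ := hf.locallyLipschitz.locallyLipschitzOn.exists_lipschitzOnWith_of_compact
    (hS.prod hS)
  obtain ⟨C, hC⟩ := (hS.prod hS).exists_bound_of_continuousOn hf.continuous.continuousOn
  have hci : ContinuousOn (fun a => (phi a)⁻¹) S :=
    (continuous_phi.inv₀ fun a => (phi_pos a).ne').continuousOn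
  obtain ⟨Q, hQ⟩ := hS.exists_bound_of_continuousOn hci
  have hq : ∀ x ∈ Icc δ (1 - δ), ∀ x' ∈ Icc δ (1 - δ),
      |quantile x' - quantile x| ≤ |Q| * |x' - x| := by
    intro x hx x' hx'
    refine (convex_Icc δ (1 - δ)).norm_image_sub_le_of_norm_hasDerivWithin_le
      (fun s hs => (hasDerivAt_quantile (hsub hs)).hasDerivWithinAt) (fun s hs => ?_) hx hx'
    exact (hQ _ (mem_image_of_mem _ hs)).trans (le_abs_self _)
  refine ⟨max |C| (K * |Q|), by positivity, fun x hx y hy => ⟨?_, fun x' hx' y' hy' => ?_⟩⟩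
  · exact ((hC (quantile x, quantile y) ⟨mem_image_of_mem _ hx, mem_image_of_mem _ hy⟩).trans
      (le_abs_self _)).trans (le_max_left _ _)
  · have h := hK.dist_le_mul (quantile x', quantile y')
      ⟨mem_image_of_mem _ hx', mem_image_of_mem _ hy'⟩ (quantile x, quantile y)
      ⟨mem_image_of_mem _ hx, mem_image_of_mem _ hy⟩
    rw [Real.dist_eq, Prod.dist_eq, Real.dist_eq, Real.dist_eq] at h
    have h1 := hq x hx x' hx'
    have h2 := hq y hy y' hy'
    have h3 : max |quantile x' - quantile x| |quantile y' - quantile y| ≤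
        |Q| * (|x' - x| + |y' - y|) := by
      have := abs_nonneg (x' - x)
      have := abs_nonneg (y' - y)
      have := abs_nonneg Q
      refine max_le (h1.trans ?_) (h2.trans ?_) <;> gcongr <;> linarith
    refine h.trans ((mul_le_mul_of_nonneg_left h3 K.coe_nonneg).trans ?_)
    rw [← mul_assoc]
    gcongr
    exact le_max_right _ _

/-- The mean value inequality applied twice, to h' and then to h, each with its Taylor polynomial
subtracted. The constant c is not optimal. -/
lemma le_taylor_two {h h' h'' : ℝ → ℝ} {c : ℝ}
    (h1 : ∀ t ∈ Icc (0 : ℝ) 1, HasDerivAt h (h' t) t)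
    (h2 : ∀ t ∈ Icc (0 : ℝ) 1, HasDerivAt h' (h'' t) t)
    (h3 : ∀ t ∈ Icc (0 : ℝ) 1, |h'' t - h'' 0| ≤ c) :
    h 1 ≤ h 0 + h' 0 + h'' 0 / 2 + c := by
  have h01 : (0 : ℝ) ∈ Icc (0 : ℝ) 1 := by simp
  have h11 : (1 : ℝ) ∈ Icc (0 : ℝ) 1 := by simp
  have hc : 0 ≤ c := (abs_nonneg _).trans (h3 0 h01)
  have hd : ∀ t ∈ Icc (0 : ℝ) 1, |h' t - h' 0 - h'' 0 * t| ≤ c := by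
    intro t ht
    have := (convex_Icc (0 : ℝ) 1).norm_image_sub_le_of_norm_hasDerivWithin_le
      (f := fun t => h' t - h'' 0 * t) (f' := fun t => h'' t - h'' 0) (C := c)
      (fun s hs => (((h2 s hs).sub
        ((hasDerivAt_id s).const_mul (h'' 0))).congr_deriv (by simp)).hasDerivWithinAt)
      (fun s hs => h3 s hs) h01 ht
    simp only [mul_zero, sub_zero, Real.norm_eq_abs, abs_of_nonneg ht.1] at this
    calc |h' t - h' 0 - h'' 0 * t| = |h' t - h'' 0 * t - h' 0| := by ring_nf
      _ ≤ c * t := this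
      _ ≤ c := by nlinarith [ht.2]
  have := (convex_Icc (0 : ℝ) 1).norm_image_sub_le_of_norm_hasDerivWithin_le
    (f := fun t => h t - h' 0 * t - h'' 0 * (t ^ 2 / 2))
    (f' := fun t => h' t - h' 0 - h'' 0 * t) (C := c)
    (fun s hs => ((((h1 s hs).sub ((hasDerivAt_id s).const_mul (h' 0))).sub
      (((hasDerivAt_pow 2 s).div_const 2).const_mul (h'' 0))).congr_deriv
        (by simp)).hasDerivWithinAt)
    (fun s hs => hd s hs) h01 h11
  simp only [Real.norm_eq_abs] at this
  have := (le_abs_self _).trans this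
  norm_num at this
  linarith

/-- Second-order upper expansion of `Lam ρ`, uniform on compact squares, with a quadratic form that
is nonpositive after damping its mixed term by `ρ`. -/
lemma Lam_expansion (hρ0 : 0 ≤ ρ) (hρ' : ρ < 1) {δ : ℝ} (hδ : 0 < δ) :
    ∃ M, 0 ≤ M ∧ ∀ x ∈ Icc δ (1 - δ), ∀ y ∈ Icc δ (1 - δ), ∃ j k A B C : ℝ,
      |A| ≤ M ∧ |B| ≤ M ∧ |C| ≤ M ∧
      (∀ p q : ℝ, A * p ^ 2 + 2 * (ρ * B) * (p * q) + C * q ^ 2 ≤ 0) ∧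
      ∀ X Y : ℝ, x + X ∈ Icc δ (1 - δ) → y + Y ∈ Icc δ (1 - δ) →
        Lam ρ (x + X) (y + Y) ≤ Lam ρ x y + (j * X + k * Y)
          + (A * X ^ 2 + 2 * B * (X * Y) + C * Y ^ 2) / 2 + M * (|X| + |Y|) ^ 3 := by
  have hρ : -1 < ρ := by linarith
  obtain ⟨M1, hM1, h1⟩ := exists_lipschitz_comp_quantile (contDiff_hessDiag (ρ := ρ)) hδ
  obtain ⟨M2, hM2, h2⟩ := exists_lipschitz_comp_quantile (contDiff_hessMixed (ρ := ρ)) hδ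
  have hsub : Icc δ (1 - δ) ⊆ Ioo (0 : ℝ) 1 := fun x hx => ⟨by linarith [hx.1], by linarith [hx.2]⟩
  refine ⟨M1 + M2, by positivity, fun x hx y hy => ?_⟩
  refine ⟨LamFst ρ x y, LamFst ρ y x, hessDiag ρ (quantile x, quantile y),
    hessMixed ρ (quantile x, quantile y), hessDiag ρ (quantile y, quantile x),
    (h1 x hx y hy).1.trans (by linarith), (h2 x hx y hy).1.trans (by linarith),
    (h1 y hy x hx).1.trans (by linarith), hess_nonpos hρ0 hρ hρ' _ _, fun X Y hX hY => ?_⟩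
  have hmem : ∀ {x X t : ℝ}, x ∈ Icc δ (1 - δ) → x + X ∈ Icc δ (1 - δ) → t ∈ Icc (0 : ℝ) 1 →
      x + t * X ∈ Icc δ (1 - δ) := by
    intro x X t hx hX ht
    have := (convex_Icc δ (1 - δ)).add_smul_mem hx hX ht
    simpa using this
  set A := fun t : ℝ => hessDiag ρ (quantile (x + t * X), quantile (y + t * Y))
  set B := fun t : ℝ => hessMixed ρ (quantile (x + t * X), quantile (y + t * Y))
  set C := fun t : ℝ => hessDiag ρ (quantile (y + t * Y), quantile (x + t * X))
  have hsymm : ∀ a b, hessMixed ρ (a, b) = hessMixed ρ (b, a) := by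
    intro a b; simp only [hessMixed, jointDensity_comm hρ hρ' a b]; ring
  have key := le_taylor_two (h := fun t => Lam ρ (x + t * X) (y + t * Y))
    (h' := fun t => LamFst ρ (x + t * X) (y + t * Y) * X + LamFst ρ (y + t * Y) (x + t * X) * Y)
    (h'' := fun t => A t * X ^ 2 + 2 * B t * (X * Y) + C t * Y ^ 2)
    (c := (M1 + M2) * (|X| + |Y|) ^ 3) ?_ ?_ ?_
  · simp only [one_mul, zero_mul, add_zero, A, B, C] at key
    linarith
  · intro t ht
    have hd : HasDerivAt (fun t : ℝ => (x + t * X, y + t * Y)) (X, Y) t := by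
      refine HasDerivAt.prodMk ?_ ?_
      · simpa using ((hasDerivAt_id t).mul_const X).const_add x
      · simpa using ((hasDerivAt_id t).mul_const Y).const_add y
    have := (hasFDerivAt_Lam hρ hρ' (p := (x + t * X, y + t * Y)) (hsub (hmem hx hX ht))
      (hsub (hmem hy hY ht))).comp_hasDerivAt t hd
    refine this.congr_deriv ?_
    simp [mul_comm]
  · intro t ht
    have e1 := hasDerivAt_LamFst_line (ρ := ρ) (hsub (hmem hx hX ht)) (hsub (hmem hy hY ht))
    have e2 := hasDerivAt_LamFst_line (ρ := ρ) (hsub (hmem hy hY ht)) (hsub (hmem hx hX ht))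
    refine ((e1.mul_const X).add (e2.mul_const Y)).congr_deriv ?_
    simp only [A, B, C]
    rw [hsymm (quantile (y + t * Y))]
    ring
  · intro t ht
    have ht' : |t| ≤ 1 := abs_le.2 ⟨by linarith [ht.1], ht.2⟩
    have b1 := (h1 x hx y hy).2 _ (hmem hx hX ht) _ (hmem hy hY ht)
    have b2 := (h2 x hx y hy).2 _ (hmem hx hX ht) _ (hmem hy hY ht)
    have b3 := (h1 y hy x hx).2 _ (hmem hy hY ht) _ (hmem hx hX ht)
    have hR : |x + t * X - x| + |y + t * Y - y| ≤ |X| + |Y| := by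
      simp only [add_sub_cancel_left, abs_mul]
      have := mul_le_mul_of_nonneg_right ht' (abs_nonneg X)
      have := mul_le_mul_of_nonneg_right ht' (abs_nonneg Y)
      linarith
    set R := |X| + |Y|
    have b1' : |A t - A 0| ≤ M1 * R := by
      simpa only [A, zero_mul, add_zero] using b1.trans (mul_le_mul_of_nonneg_left hR hM1)
    have b2' : |B t - B 0| ≤ M2 * R := by
      simpa only [B, zero_mul, add_zero] using b2.trans (mul_le_mul_of_nonneg_left hR hM2)
    have b3' : |C t - C 0| ≤ M1 * R := by
      rw [add_comm |_|] at hR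
      simpa only [C, zero_mul, add_zero] using b3.trans (mul_le_mul_of_nonneg_left hR hM1)
    have hX0 := abs_nonneg X
    have hY0 := abs_nonneg Y
    have hR0 : 0 ≤ R := by positivity
    calc |A t * X ^ 2 + 2 * B t * (X * Y) + C t * Y ^ 2
          - (A 0 * X ^ 2 + 2 * B 0 * (X * Y) + C 0 * Y ^ 2)|
        = |(A t - A 0) * X ^ 2 + 2 * (B t - B 0) * (X * Y) + (C t - C 0) * Y ^ 2| := by ring_nf
      _ ≤ |A t - A 0| * |X| ^ 2 + 2 * |B t - B 0| * (|X| * |Y|) + |C t - C 0| * |Y| ^ 2 := by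
        refine (abs_add_three _ _ _).trans (le_of_eq ?_)
        simp only [abs_mul, abs_pow, abs_two]
      _ ≤ M1 * R * |X| ^ 2 + 2 * (M2 * R) * (|X| * |Y|) + M1 * R * |Y| ^ 2 := by gcongr
      _ ≤ (M1 + M2) * R ^ 3 := by
        have : (M1 + M2) * R ^ 3 - (M1 * R * |X| ^ 2 + 2 * (M2 * R) * (|X| * |Y|)
          + M1 * R * |Y| ^ 2) = R * (M1 * (2 * (|X| * |Y|)) + M2 * (|X| ^ 2 + |Y| ^ 2)) := by
          simp only [R]; ring
        have : 0 ≤ R * (M1 * (2 * (|X| * |Y|)) + M2 * (|X| ^ 2 + |Y| ^ 2)) := by positivity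
        linarith

end LamDeriv

end Borell

namespace Borell

/-! ### One small Gaussian increment, with a third-order error. -/

section OneStep

open Set Filter Topology

/-- `F` has the continuous first derivative `D`, bounded by `K`, with a quadratic remainder. -/
structure HasQuadraticRemainder {E : Type*} [NormedAddCommGroup E] [NormedSpace ℝ E]
    (K : ℝ) (F : E → ℝ) (D : E → E →L[ℝ] ℝ) : Prop where
  continuous : Continuous F
  continuous_deriv : Continuous D
  norm_deriv_le : ∀ x, ‖D x‖ ≤ K
  remainder_le : ∀ x h, |F (x + h) - F x - D x h| ≤ K * ‖h‖ ^ 2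

/-- Replaces the true increments X, Y by their linear parts rl, rl'. Each product changes by at most
3MK²r³N², and the four products, halved, give 6. Since |X| and |Y| are at most 2KrN, the cubic term
gives 4³ = 64. -/
lemma quadratic_perturbation_le {A B C M K r N X Y l l' : ℝ} (hM : 0 ≤ M) (hK : 0 ≤ K)
    (hr : r ∈ Icc (0 : ℝ) 1) (hN : 1 ≤ N) (hA : |A| ≤ M) (hB : |B| ≤ M) (hC : |C| ≤ M)
    (hX : |X - r * l| ≤ K * r ^ 2 * N) (hY : |Y - r * l'| ≤ K * r ^ 2 * N)
    (hl : |l| ≤ K * N) (hl' : |l'| ≤ K * N) :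
    (A * X ^ 2 + 2 * B * (X * Y) + C * Y ^ 2) / 2 + M * (|X| + |Y|) ^ 3 ≤
      r ^ 2 * (A * l ^ 2 + 2 * B * (l * l') + C * l' ^ 2) / 2
        + M * (6 * K ^ 2 + 64 * K ^ 3) * r ^ 3 * N ^ 3 := by
  obtain ⟨hr0, hr1⟩ := hr
  have hrl : ∀ {l : ℝ}, |l| ≤ K * N → |r * l| ≤ K * r * N := fun {l} h => by
    rw [abs_mul, abs_of_nonneg hr0]
    calc r * |l| ≤ r * (K * N) := by gcongr
      _ = K * r * N := by ring
  have hXb : ∀ {X l : ℝ}, |X - r * l| ≤ K * r ^ 2 * N → |l| ≤ K * N → |X| ≤ 2 * (K * r * N) := by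
    intro X l h1 h2
    have h3 : K * r ^ 2 * N ≤ K * r * N := by
      have : r ^ 2 ≤ r := by nlinarith
      gcongr
    calc |X| = |(X - r * l) + r * l| := by ring_nf
      _ ≤ |X - r * l| + |r * l| := abs_add_le _ _
      _ ≤ 2 * (K * r * N) := by linarith [hrl h2]
  have hX2 := hXb hX hl
  have hY2 := hXb hY hl'
  have cross : ∀ {U X Y l l' : ℝ}, |U| ≤ M → |X - r * l| ≤ K * r ^ 2 * N →
      |Y - r * l'| ≤ K * r ^ 2 * N → |l| ≤ K * N → |Y| ≤ 2 * (K * r * N) →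
      U * (X * Y) - U * (r ^ 2 * (l * l')) ≤ 3 * (M * K ^ 2 * r ^ 3 * N ^ 2) := by
    intro U X Y l l' hU h1 h2 h3 h4
    have h5 := hrl h3
    calc U * (X * Y) - U * (r ^ 2 * (l * l'))
        = U * ((X - r * l) * Y + (r * l) * (Y - r * l')) := by ring
      _ ≤ |U| * (|X - r * l| * |Y| + |r * l| * |Y - r * l'|) := by
        refine (le_abs_self _).trans ?_
        rw [abs_mul]
        gcongr
        refine (abs_add_le _ _).trans ?_
        rw [abs_mul, abs_mul]
      _ ≤ M * ((K * r ^ 2 * N) * (2 * (K * r * N)) + (K * r * N) * (K * r ^ 2 * N)) := by gcongr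
      _ = 3 * (M * K ^ 2 * r ^ 3 * N ^ 2) := by ring
  have c1 := cross hA hX hX hl hX2
  have c2 := cross hB hX hY hl hY2
  have c3 := cross hC hY hY hl' hY2
  have c4 : M * (|X| + |Y|) ^ 3 ≤ 64 * (M * K ^ 3 * r ^ 3 * N ^ 3) := by
    calc M * (|X| + |Y|) ^ 3 ≤ M * (2 * (K * r * N) + 2 * (K * r * N)) ^ 3 := by gcongr
      _ = 64 * (M * K ^ 3 * r ^ 3 * N ^ 3) := by ring
  have c5 : M * K ^ 2 * r ^ 3 * N ^ 2 ≤ M * K ^ 2 * r ^ 3 * N ^ 3 := by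
    have : N ^ 2 ≤ N ^ 3 := pow_le_pow_right₀ hN (by norm_num)
    gcongr
  linarith

lemma integral_linear_combination {X : Type*} [MeasurableSpace X] {ν : Measure X} {f g h : X → ℝ}
    (hf : Integrable f ν) (hg : Integrable g ν) (hh : Integrable h ν) (a b c : ℝ) :
    ∫ x, (a * f x + b * g x + c * h x) ∂ν =
      a * ∫ x, f x ∂ν + b * ∫ x, g x ∂ν + c * ∫ x, h x ∂ν := by
  have hi : Integrable (fun x => a * f x + b * g x) ν := (hf.const_mul a).add (hg.const_mul b)
  rw [integral_add hi (hh.const_mul c), integral_add (hf.const_mul a) (hg.const_mul b),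
    integral_const_mul, integral_const_mul, integral_const_mul]

variable {E : Type*} [NormedAddCommGroup E] [NormedSpace ℝ E] [MeasurableSpace E] [BorelSpace E]
  {μ : Measure E} [IsGaussian μ] {ρ : ℝ}

lemma integrable_clm_mul_clm (L L' : E →L[ℝ] ℝ) : Integrable (fun x => L x * L' x) μ :=
  (IsGaussian.memLp_dual μ L 2 (by norm_num)).integrable_mul
    (IsGaussian.memLp_dual μ L' 2 (by norm_num))

variable [SecondCountableTopology E]

lemma integral_comp_fst_correlatedLaw {f : E → ℝ} (hf : AEStronglyMeasurable f μ) :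
    ∫ p, f p.1 ∂(correlatedLaw μ ρ) = ∫ x, f x ∂μ :=
  (measurePreserving_fst_correlatedLaw μ ρ).hasLaw.integral_comp hf

variable [CompleteSpace E]

lemma integral_comp_snd_correlatedLaw (hμ : μ[id] = 0) (hρ : -1 < ρ) (hρ' : ρ < 1) {f : E → ℝ}
    (hf : AEStronglyMeasurable f μ) :
    ∫ p, f p.2 ∂(correlatedLaw μ ρ) = ∫ x, f x ∂μ :=
  (measurePreserving_snd_correlatedLaw hμ hρ hρ').hasLaw.integral_comp hf

lemma integrable_norm_pow (n : ℕ) : Integrable (fun x : E => ‖x‖ ^ n) μ :=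
  (IsGaussian.memLp_id μ n (ENNReal.natCast_ne_top n)).integrable_norm_pow'

lemma integral_clm_eq_zero (hμ : μ[id] = 0) (L : E →L[ℝ] ℝ) : ∫ x, L x ∂μ = 0 := by
  have := IsGaussian.integral_dual (μ := μ) L
  simp only [id_eq] at hμ
  rw [this, hμ, map_zero]

/-- The independent part of the second component contributes a product of zero means. This is the
source of the factor ρ on the mixed Hessian term. -/
lemma integral_mul_correlatedLaw (hμ : μ[id] = 0) (L L' : E →L[ℝ] ℝ) :
    ∫ p, L p.1 * L' p.2 ∂(correlatedLaw μ ρ) = ρ * ∫ x, L x * L' x ∂μ := by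
  have h1 := (measurePreserving_correlate μ ρ).hasLaw.integral_comp
    (f := fun p : E × E => L p.1 * L' p.2) (by fun_prop)
  rw [← h1]
  have h2 : ∀ p : E × E, ((fun p : E × E => L p.1 * L' p.2) ∘ correlate E ρ) p =
      ρ * (L p.1 * L' p.1) + √(1 - ρ ^ 2) * (L p.1 * L' p.2) := by
    intro p
    simp only [Function.comp, correlate_apply, map_add, map_smul, smul_eq_mul]
    ring
  simp_rw [h2]
  have i1 : Integrable (fun p : E × E => L p.1 * L' p.1) (μ.prod μ) :=
    (integrable_clm_mul_clm L L').comp_fst μ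
  have i2 : Integrable (fun p : E × E => L p.1 * L' p.2) (μ.prod μ) :=
    (IsGaussian.integrable_dual μ L).mul_prod (IsGaussian.integrable_dual μ L')
  rw [integral_add (i1.const_mul _) (i2.const_mul _), integral_const_mul, integral_const_mul,
    integral_prod_mul (fun x => L x) (fun x => L' x), integral_clm_eq_zero hμ L,
    integral_fun_fst (fun x => L x * L' x)]
  simp

lemma integrable_comp_of_bounded {X : Type*} [TopologicalSpace X] [MeasurableSpace X]
    [OpensMeasurableSpace X] {ν : Measure X} [IsFiniteMeasure ν] {f : X → ℝ}
    (hf : Continuous f) {c : ℝ} (hb : ∀ x, |f x| ≤ c) : Integrable f ν :=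
  Integrable.of_bound hf.measurable.aestronglyMeasurable c (ae_of_all _ hb)

lemma abs_le_one_of_mem {δ x : ℝ} (hδ : 0 < δ) (hx : x ∈ Icc δ (1 - δ)) : |x| ≤ 1 :=
  abs_le.2 ⟨by linarith [hx.1], by linarith [hx.2]⟩

lemma integral_mem_Icc {X : Type*} [MeasurableSpace X] {ν : Measure X} [IsProbabilityMeasure ν]
    {f : X → ℝ} (hf : Integrable f ν) {a b : ℝ} (h : ∀ x, f x ∈ Icc a b) :
    ∫ x, f x ∂ν ∈ Icc a b := by
  constructor
  · simpa using integral_mono (integrable_const a) hf fun x => (h x).1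
  · simpa using integral_mono hf (integrable_const b) fun x => (h x).2

/-- The functional inequality up to a third-order error, for increments of scale `r`. -/
lemma small_increment_inequality (hμ : μ[id] = 0) (hρ0 : 0 ≤ ρ) (hρ' : ρ < 1) {δ K : ℝ}
    (hδ : 0 < δ) (hK : 0 ≤ K) :
    ∃ M, 0 ≤ M ∧ ∀ (F G : E → ℝ) (D D' : E → E →L[ℝ] ℝ), HasQuadraticRemainder K F D →
      HasQuadraticRemainder K G D' → (∀ x, F x ∈ Icc δ (1 - δ)) → (∀ x, G x ∈ Icc δ (1 - δ)) →
      ∀ r ∈ Icc (0 : ℝ) 1, ∀ a b : E,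
        ∫ p, Lam ρ (F (a + r • p.1)) (G (b + r • p.2)) ∂(correlatedLaw μ ρ) ≤
          Lam ρ (∫ x, F (a + r • x) ∂μ) (∫ x, G (b + r • x) ∂μ) + M * r ^ 3 := by
  have hρ : -1 < ρ := by linarith
  obtain ⟨M, hM, hexp⟩ := Lam_expansion hρ0 hρ' hδ
  set c := ∫ x, ‖x‖ ^ 2 ∂μ with hc
  have hc0 : 0 ≤ c := integral_nonneg fun _ => by positivity
  -- A single weight that dominates 1, the norms of both components and both centered remainders;
  -- its cube is integrable because Gaussians have sixth moments.
  set N : E × E → ℝ := fun p => 1 + c + ‖p.1‖ ^ 2 + ‖p.2‖ ^ 2 with hN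
  have hN1 : ∀ p, 1 ≤ N p := fun p => by
    simp only [hN]; nlinarith [sq_nonneg ‖p.1‖, sq_nonneg ‖p.2‖]
  have hNi : Integrable (fun p => N p ^ 3) (correlatedLaw μ ρ) := by
    have h6 : Integrable (fun p : E × E => ‖p‖ ^ 6) (correlatedLaw μ ρ) := integrable_norm_pow 6
    refine (((integrable_const ((1 + c) ^ 3)).add (h6.const_mul 8)).const_mul 4).mono'
      (by fun_prop) (ae_of_all _ fun p => ?_)
    have hp1 := norm_fst_le p
    have hp2 := norm_snd_le p
    have hNp : N p ≤ (1 + c) + 2 * ‖p‖ ^ 2 := by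
      have : ‖p.1‖ ^ 2 ≤ ‖p‖ ^ 2 := by gcongr
      have : ‖p.2‖ ^ 2 ≤ ‖p‖ ^ 2 := by gcongr
      simp only [hN]; linarith
    have h0 := hN1 p
    rw [Real.norm_eq_abs, abs_of_nonneg (by positivity)]
    have := add_pow_le (show 0 ≤ 1 + c by positivity) (show 0 ≤ 2 * ‖p‖ ^ 2 by positivity) 3
    calc N p ^ 3 ≤ ((1 + c) + 2 * ‖p‖ ^ 2) ^ 3 := by gcongr
      _ ≤ _ := this
      _ = _ := by norm_num; ring
  refine ⟨M * (6 * K ^ 2 + 64 * K ^ 3) * ∫ p, N p ^ 3 ∂(correlatedLaw μ ρ), ?_, ?_⟩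
  · have : 0 ≤ ∫ p, N p ^ 3 ∂(correlatedLaw μ ρ) :=
      integral_nonneg fun p => by have := hN1 p; positivity
    positivity
  intro F G D D' hF hG hFm hGm r hr a b
  -- The linear part has mean zero, so the mean of F(a + rx) differs from F(a) by only K r² c.
  -- Centering at the mean therefore costs no first-order term.
  have main : ∀ {F : E → ℝ} {D : E → E →L[ℝ] ℝ}, HasQuadraticRemainder K F D →
      (∀ x, F x ∈ Icc δ (1 - δ)) → ∀ a : E, Integrable (fun x => F (a + r • x)) μ ∧
        ∀ x, |F (a + r • x) - (∫ x, F (a + r • x) ∂μ) - r * D a x| ≤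
          K * r ^ 2 * (c + ‖x‖ ^ 2) := by
    intro F D hF hFm a
    have hi : Integrable (fun x => F (a + r • x)) μ :=
      integrable_comp_of_bounded (hF.continuous.comp (by fun_prop))
        fun x => abs_le_one_of_mem hδ (hFm _)
    have hrem : ∀ x, |F (a + r • x) - F a - r * D a x| ≤ K * r ^ 2 * ‖x‖ ^ 2 := by
      intro x
      have := hF.remainder_le a (r • x)
      rwa [map_smul, smul_eq_mul, norm_smul, Real.norm_eq_abs, mul_pow, sq_abs, ← mul_assoc] at this
    have hmean : |(∫ x, F (a + r • x) ∂μ) - F a| ≤ K * r ^ 2 * c := by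
      have e : (∫ x, F (a + r • x) ∂μ) - F a = ∫ x, (F (a + r • x) - F a - r * D a x) ∂μ := by
        have hi' : Integrable (fun x => F (a + r • x) - F a) μ := hi.sub (integrable_const _)
        rw [integral_sub hi'
          ((IsGaussian.integrable_dual μ (D a)).const_mul r), integral_sub hi (integrable_const _),
          integral_const_mul, integral_clm_eq_zero hμ]
        simp
      rw [e, hc, ← integral_const_mul]
      exact norm_integral_le_of_norm_le
        (f := fun x => F (a + r • x) - F a - r * D a x)
        ((integrable_norm_pow (μ := μ) 2).const_mul (K * r ^ 2)) (ae_of_all _ hrem)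
    refine ⟨hi, fun x => ?_⟩
    calc |F (a + r • x) - (∫ x, F (a + r • x) ∂μ) - r * D a x|
        = |(F (a + r • x) - F a - r * D a x) - ((∫ x, F (a + r • x) ∂μ) - F a)| := by ring_nf
      _ ≤ _ := abs_sub _ _
      _ ≤ _ := by linarith [hrem x]
  obtain ⟨hFi, hFr⟩ := main hF hFm a
  obtain ⟨hGi, hGr⟩ := main hG hGm b
  set x := ∫ x, F (a + r • x) ∂μ
  set y := ∫ x, G (b + r • x) ∂μ
  -- Expanding about the means makes the coefficients j, k irrelevant: X and Y integrate to zero.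
  obtain ⟨j, k, A, B, C, hA, hB, hC, hneg, hup⟩ :=
    hexp x (integral_mem_Icc hFi fun _ => hFm _) y (integral_mem_Icc hGi fun _ => hGm _)
  set L := D a
  set L' := D' b
  set X : E × E → ℝ := fun p => F (a + r • p.1) - x with hX
  set Y : E × E → ℝ := fun p => G (b + r • p.2) - y with hY
  set Q : E × E → ℝ := fun p => A * (L p.1 * L p.1) + 2 * B * (L p.1 * L' p.2)
    + C * (L' p.2 * L' p.2) with hQ
  have hpt : ∀ p, Lam ρ (F (a + r • p.1)) (G (b + r • p.2)) ≤
      Lam ρ x y + (j * X p + k * Y p) + r ^ 2 / 2 * Q p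
        + M * (6 * K ^ 2 + 64 * K ^ 3) * r ^ 3 * N p ^ 3 := by
    intro p
    have h1 := hup (X p) (Y p) (by simpa [hX] using hFm _) (by simpa [hY] using hGm _)
    have hn : ∀ {u : E} {T : E →L[ℝ] ℝ}, ‖T‖ ≤ K → 1 + ‖u‖ ^ 2 ≤ N p → |T u| ≤ K * N p := by
      intro u T hT hu
      refine (T.le_opNorm u).trans ?_
      have : ‖u‖ ≤ N p := by nlinarith [sq_nonneg (‖u‖ - 1)]
      gcongr
    have h2 := quadratic_perturbation_le (X := X p) (Y := Y p) (l := L p.1) (l' := L' p.2) hM hK hr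
      (hN1 p) hA hB hC
      ((hFr p.1).trans (by
        have := hr.1
        gcongr; simp only [hN]; nlinarith [sq_nonneg ‖p.2‖]))
      ((hGr p.2).trans (by
        have := hr.1
        gcongr; simp only [hN]; nlinarith [sq_nonneg ‖p.1‖]))
      (hn (hF.norm_deriv_le a) (by simp only [hN]; nlinarith [sq_nonneg ‖p.2‖]))
      (hn (hG.norm_deriv_le b) (by simp only [hN]; nlinarith [sq_nonneg ‖p.1‖]))
    have e1 : x + X p = F (a + r • p.1) := by simp [hX]
    have e2 : y + Y p = G (b + r • p.2) := by simp [hY]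
    rw [e1, e2] at h1
    have e3 : r ^ 2 / 2 * Q p = r ^ 2 * (A * L p.1 ^ 2 + 2 * B * (L p.1 * L' p.2)
      + C * L' p.2 ^ 2) / 2 := by simp only [hQ]; ring
    rw [e3]
    linarith
  have hfst := measurePreserving_fst_correlatedLaw μ ρ
  have hsnd := measurePreserving_snd_correlatedLaw hμ hρ hρ'
  have hXi : Integrable X (correlatedLaw μ ρ) :=
    (hfst.integrable_comp_of_integrable (hFi.sub (integrable_const x)))
  have hYi : Integrable Y (correlatedLaw μ ρ) :=
    (hsnd.integrable_comp_of_integrable (hGi.sub (integrable_const y)))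
  have hX0 : ∫ p, X p ∂(correlatedLaw μ ρ) = 0 := by
    rw [integral_comp_fst_correlatedLaw (f := fun u => F (a + r • u) - x)
      (hFi.sub (integrable_const x)).aestronglyMeasurable, integral_sub hFi (integrable_const _)]
    simp [x]
  have hY0 : ∫ p, Y p ∂(correlatedLaw μ ρ) = 0 := by
    rw [integral_comp_snd_correlatedLaw hμ hρ hρ' (f := fun u => G (b + r • u) - y)
      (hGi.sub (integrable_const y)).aestronglyMeasurable, integral_sub hGi (integrable_const _)]
    simp [y]
  have i1 : Integrable (fun p : E × E => L p.1 * L p.1) (correlatedLaw μ ρ) :=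
    hfst.integrable_comp_of_integrable (integrable_clm_mul_clm L L)
  have i3 : Integrable (fun p : E × E => L' p.2 * L' p.2) (correlatedLaw μ ρ) :=
    hsnd.integrable_comp_of_integrable (integrable_clm_mul_clm L' L')
  have i2 : Integrable (fun p : E × E => L p.1 * L' p.2) (correlatedLaw μ ρ) :=
    integrable_clm_mul_clm (μ := correlatedLaw μ ρ) (L.comp (ContinuousLinearMap.fst ℝ E E))
      (L'.comp (ContinuousLinearMap.snd ℝ E E))
  have hQi : Integrable Q (correlatedLaw μ ρ) :=
    ((i1.const_mul A).add (i2.const_mul (2 * B))).add (i3.const_mul C)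
  -- Integration turns the mixed coefficient B into ρB, with both functionals at the same point; the
  -- damped form `hneg` is then pointwise nonpositive.
  have hQ0 : ∫ p, Q p ∂(correlatedLaw μ ρ) ≤ 0 := by
    simp only [hQ]
    rw [integral_linear_combination i1 i2 i3, integral_mul_correlatedLaw hμ,
      integral_comp_fst_correlatedLaw (f := fun u => L u * L u)
        (integrable_clm_mul_clm L L).aestronglyMeasurable,
      integral_comp_snd_correlatedLaw hμ hρ hρ' (f := fun u => L' u * L' u)
        (integrable_clm_mul_clm L' L').aestronglyMeasurable]
    have j1 := integrable_clm_mul_clm (μ := μ) L L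
    have j2 := integrable_clm_mul_clm (μ := μ) L L'
    have j3 := integrable_clm_mul_clm (μ := μ) L' L'
    have : ∫ u, (A * (L u * L u) + 2 * (ρ * B) * (L u * L' u) + C * (L' u * L' u)) ∂μ ≤ 0 :=
      integral_nonpos fun u => by
        have := hneg (L u) (L' u)
        rw [pow_two, pow_two] at this
        exact this
    rw [integral_linear_combination j1 j2 j3] at this
    linarith
  have hLi : Integrable (fun p : E × E => Lam ρ (F (a + r • p.1)) (G (b + r • p.2)))
      (correlatedLaw μ ρ) := by
    refine integrable_comp_of_bounded (c := 1) ((continuous_Lam hρ hρ').comp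
      ((hF.continuous.comp (by fun_prop)).prodMk (hG.continuous.comp (by fun_prop)))) fun p => ?_
    rw [abs_of_nonneg (Lam_nonneg _ _)]; exact Lam_le_one _ _
  have iXY := (hXi.const_mul j).add (hYi.const_mul k)
  have i4 := (integrable_const (μ := correlatedLaw μ ρ) (Lam ρ x y)).add iXY
  have i5 := i4.add (hQi.const_mul (r ^ 2 / 2))
  have i6 := hNi.const_mul (M * (6 * K ^ 2 + 64 * K ^ 3) * r ^ 3)
  refine (integral_mono hLi (i5.add i6) hpt).trans ?_
  rw [integral_add' i5 i6, integral_add' i4 (hQi.const_mul _),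
    integral_add' (integrable_const _) iXY, integral_add' (hXi.const_mul j) (hYi.const_mul k),
    integral_const_mul, integral_const_mul, integral_const_mul, integral_const_mul, hX0, hY0]
  have : r ^ 2 / 2 * ∫ p, Q p ∂(correlatedLaw μ ρ) ≤ 0 :=
    mul_nonpos_of_nonneg_of_nonpos (by positivity) hQ0
  simp only [integral_const, probReal_univ, one_smul]
  linarith

end OneStep

end Borell

namespace Borell

/-! ### Accumulating increments: the inequality for smooth functions. -/

section SmoothInequality

open Set Filter Topology

variable {E : Type*} [NormedAddCommGroup E] [NormedSpace ℝ E] [MeasurableSpace E] [BorelSpace E]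
  [SecondCountableTopology E]

/-- Averaging over translates keeps the same K, so the error constant does not grow along the
induction on increments. -/
lemma HasQuadraticRemainder.average {ν : Measure E} [IsProbabilityMeasure ν] {K : ℝ} {F : E → ℝ}
    {D : E → E →L[ℝ] ℝ} (hF : HasQuadraticRemainder K F D) {c : ℝ} (hb : ∀ x, |F x| ≤ c) :
    HasQuadraticRemainder K (fun x => ∫ u, F (x + u) ∂ν) (fun x => ∫ u, D (x + u) ∂ν) := by
  have hFi : ∀ x, Integrable (fun u => F (x + u)) ν := fun x =>
    integrable_comp_of_bounded (hF.continuous.comp (by fun_prop)) fun u => hb _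
  have hDi : ∀ x, Integrable (fun u => D (x + u)) ν := fun x =>
    Integrable.of_bound (hF.continuous_deriv.comp (by fun_prop)).aestronglyMeasurable K
      (ae_of_all _ fun u => hF.norm_deriv_le _)
  refine ⟨?_, ?_, fun x => ?_, fun x h => ?_⟩
  · refine continuous_of_dominated (bound := fun _ => c) (fun x => (hFi x).aestronglyMeasurable)
      (fun x => ae_of_all _ fun u => hb _) (integrable_const _) (ae_of_all _ fun u => ?_)
    exact hF.continuous.comp (by fun_prop)
  · refine continuous_of_dominated (bound := fun _ => K) (fun x => (hDi x).aestronglyMeasurable)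
      (fun x => ae_of_all _ fun u => hF.norm_deriv_le _) (integrable_const _)
      (ae_of_all _ fun u => ?_)
    exact hF.continuous_deriv.comp (by fun_prop)
  · simpa using norm_integral_le_of_norm_le_const (μ := ν)
      (ae_of_all _ fun u => hF.norm_deriv_le (x + u))
  · have hDh : Integrable (fun u => D (x + u) h) ν := (hDi x).apply_continuousLinearMap h
    have hFF : Integrable (fun u => F (x + h + u) - F (x + u)) ν := (hFi _).sub (hFi _)
    rw [ContinuousLinearMap.integral_apply (hDi x), ← integral_sub (hFi _) (hFi _),
      ← integral_sub hFF hDh]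
    have := norm_integral_le_of_norm_le_const (μ := ν)
      (f := fun u => F (x + h + u) - F (x + u) - D (x + u) h) (C := K * ‖h‖ ^ 2)
      (ae_of_all _ fun u => by
        rw [show x + h + u = x + u + h by abel]
        exact hF.remainder_le (x + u) h)
    simpa using this

variable [CompleteSpace E] {μ : Measure E} [IsGaussian μ] {ρ : ℝ}

/-- In law, √(k+1) x is √k x + y with x, y independent copies. Stated for a general space V so that
it also applies to the correlated pair, itself a centered Gaussian. -/
lemma integral_sqrt_succ_smul {V : Type*} [NormedAddCommGroup V] [NormedSpace ℝ V]
    [MeasurableSpace V] [BorelSpace V] [SecondCountableTopology V] [CompleteSpace V]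
    {ν : Measure V} [IsGaussian ν] (hν : ν[id] = 0) {f : V → ℝ} (hf : Continuous f) {c : ℝ}
    (hb : ∀ x, |f x| ≤ c) (k : ℕ) (r : ℝ) :
    ∫ x, f ((√(k + 1 : ℕ) * r) • x) ∂ν = ∫ x, ∫ y, f ((√k * r) • x + r • y) ∂ν ∂ν := by
  have hk : (0 : ℝ) < √(k + 1 : ℕ) := Real.sqrt_pos.2 (by positivity)
  have hsq : √(k + 1 : ℕ) ^ 2 = (k : ℝ) + 1 := by
    rw [Real.sq_sqrt (by positivity)]; push_cast; ring
  have hsum : (√k / √(k + 1 : ℕ)) ^ 2 + (1 / √(k + 1 : ℕ)) ^ 2 = 1 := by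
    rw [div_pow, div_pow, hsq, Real.sq_sqrt (by positivity)]
    field_simp
  have hmp := measurePreserving_smul_add_smul hν hsum
  have h1 := hmp.hasLaw.integral_comp (f := fun x => f ((√(k + 1 : ℕ) * r) • x))
    (hf.comp (by fun_prop)).aestronglyMeasurable
  rw [← h1]
  have h2 : ((fun x => f ((√(k + 1 : ℕ) * r) • x)) ∘
      fun p : V × V => (√k / √(k + 1 : ℕ)) • p.1 + (1 / √(k + 1 : ℕ)) • p.2) =
      fun p => f ((√k * r) • p.1 + r • p.2) := by
    ext p
    simp only [Function.comp, smul_add, smul_smul]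
    congr 3
    · field_simp
    · field_simp
  rw [h2, integral_prod]
  exact integrable_comp_of_bounded (hf.comp (by fun_prop)) fun _ => hb _

lemma continuous_Lam_comp {X : Type*} [TopologicalSpace X] (hρ : -1 < ρ) (hρ' : ρ < 1)
    {f g : X → ℝ} (hf : Continuous f) (hg : Continuous g) :
    Continuous fun x => Lam ρ (f x) (g x) :=
  (continuous_Lam hρ hρ').comp (hf.prodMk hg)

lemma abs_Lam_le_one (α β : ℝ) : |Lam ρ α β| ≤ 1 := by
  rw [abs_of_nonneg (Lam_nonneg _ _)]; exact Lam_le_one _ _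

/-- Accumulating `k` increments of scale `r` costs `k` third-order errors. -/
lemma increments_inequality (hμ : μ[id] = 0) (hρ0 : 0 ≤ ρ) (hρ' : ρ < 1) {δ K : ℝ}
    (hδ : 0 < δ) (hK : 0 ≤ K) :
    ∃ M, 0 ≤ M ∧ ∀ r ∈ Icc (0 : ℝ) 1, ∀ (k : ℕ) (F G : E → ℝ) (D D' : E → E →L[ℝ] ℝ),
      HasQuadraticRemainder K F D → HasQuadraticRemainder K G D' →
      (∀ x, F x ∈ Icc δ (1 - δ)) → (∀ x, G x ∈ Icc δ (1 - δ)) →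
        ∫ p, Lam ρ (F ((√k * r) • p.1)) (G ((√k * r) • p.2)) ∂(correlatedLaw μ ρ) ≤
          Lam ρ (∫ x, F ((√k * r) • x) ∂μ) (∫ x, G ((√k * r) • x) ∂μ) + k * (M * r ^ 3) := by
  have hρ : -1 < ρ := by linarith
  obtain ⟨M, hM, hstep⟩ := small_increment_inequality (μ := μ) hμ hρ0 hρ' hδ hK
  refine ⟨M, hM, fun r hr k => ?_⟩
  induction k with
  | zero => intro F G D D' _ _ _ _; simp
  | succ k ih =>
    intro F G D D' hF hG hFm hGm
    have hFb : ∀ x, |F x| ≤ 1 := fun x => abs_le_one_of_mem hδ (hFm x)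
    have hGb : ∀ x, |G x| ≤ 1 := fun x => abs_le_one_of_mem hδ (hGm x)
    have hmap : ∀ (F : E → ℝ), Continuous F → ∀ x,
        ∫ u, F (x + u) ∂(μ.map (fun u => r • u)) = ∫ u, F (x + r • u) ∂μ := fun F hF x =>
      integral_map (by fun_prop) (hF.comp (by fun_prop)).aestronglyMeasurable
    have : IsProbabilityMeasure (μ.map (fun u => r • u)) :=
      Measure.isProbabilityMeasure_map (by fun_prop)
    have hF' := hF.average (ν := μ.map (fun u => r • u)) hFb
    have hG' := hG.average (ν := μ.map (fun u => r • u)) hGb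
    simp_rw [hmap F hF.continuous] at hF'
    simp_rw [hmap G hG.continuous] at hG'
    have hmem : ∀ {F : E → ℝ}, Continuous F → (∀ x, F x ∈ Icc δ (1 - δ)) → ∀ x,
        ∫ u, F (x + r • u) ∂μ ∈ Icc δ (1 - δ) := fun hc hm x =>
      integral_mem_Icc (integrable_comp_of_bounded (hc.comp (by fun_prop))
        fun _ => abs_le_one_of_mem hδ (hm _)) fun _ => hm _
    -- The induction hypothesis is used for the functions already averaged over the last increment;
    -- their means over k increments are those of F and G over k + 1.
    have key := ih _ _ _ _ hF' hG' (hmem hF.continuous hFm) (hmem hG.continuous hGm)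
    rw [← integral_sqrt_succ_smul hμ hF.continuous hFb,
      ← integral_sqrt_succ_smul hμ hG.continuous hGb] at key
    have hLc : Continuous fun p : E × E => Lam ρ (F p.1) (G p.2) :=
      continuous_Lam_comp hρ hρ' (hF.continuous.comp continuous_fst)
        (hG.continuous.comp continuous_snd)
    have hsplit := integral_sqrt_succ_smul (ν := correlatedLaw μ ρ)
      (integral_id_correlatedLaw hμ hρ hρ') hLc (fun p => abs_Lam_le_one _ _) k r
    simp only [Prod.smul_fst, Prod.smul_snd, Prod.fst_add, Prod.snd_add] at hsplit
    rw [hsplit]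
    have i1 : Integrable (fun p : E × E => ∫ q : E × E, Lam ρ (F ((√k * r) • p.1 + r • q.1))
        (G ((√k * r) • p.2 + r • q.2)) ∂(correlatedLaw μ ρ)) (correlatedLaw μ ρ) := by
      refine Integrable.integral_prod_left (f := fun z : (E × E) × (E × E) =>
        Lam ρ (F ((√k * r) • z.1.1 + r • z.2.1)) (G ((√k * r) • z.1.2 + r • z.2.2))) ?_
      refine integrable_comp_of_bounded (continuous_Lam_comp hρ hρ' (hF.continuous.comp ?_)
        (hG.continuous.comp ?_)) (fun p => abs_Lam_le_one _ _)
      · fun_prop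
      · fun_prop
    have i2 : Integrable (fun p : E × E => Lam ρ (∫ u, F ((√k * r) • p.1 + r • u) ∂μ)
        (∫ u, G ((√k * r) • p.2 + r • u) ∂μ)) (correlatedLaw μ ρ) :=
      integrable_comp_of_bounded (continuous_Lam_comp hρ hρ'
        (hF'.continuous.comp (f := fun p : E × E => (√k * r) • p.1) (by fun_prop))
        (hG'.continuous.comp (f := fun p : E × E => (√k * r) • p.2) (by fun_prop)))
        (fun p => abs_Lam_le_one _ _)
    -- One-step inequality for the last increment, conditionally on the sum of the first k. Its
    -- error is uniform in the base points.
    have hmono := integral_mono i1 (i2.add (integrable_const (M * r ^ 3)))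
      fun p => hstep F G D D' hF hG hFm hGm r hr ((√k * r) • p.1) ((√k * r) • p.2)
    rw [integral_add' i2 (integrable_const _)] at hmono
    simp only [integral_const, probReal_univ, one_smul] at hmono
    push_cast at key ⊢
    linarith

/-- The functional inequality for functions with bounded second-order behaviour. -/
lemma smooth_inequality (hμ : μ[id] = 0) (hρ0 : 0 ≤ ρ) (hρ' : ρ < 1) {δ K : ℝ}
    (hδ : 0 < δ) (hK : 0 ≤ K) {F G : E → ℝ} {D D' : E → E →L[ℝ] ℝ}
    (hF : HasQuadraticRemainder K F D) (hG : HasQuadraticRemainder K G D')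
    (hFm : ∀ x, F x ∈ Icc δ (1 - δ)) (hGm : ∀ x, G x ∈ Icc δ (1 - δ)) :
    ∫ p, Lam ρ (F p.1) (G p.2) ∂(correlatedLaw μ ρ) ≤
      Lam ρ (∫ x, F x ∂μ) (∫ x, G x ∂μ) := by
  obtain ⟨M, hM, h⟩ := increments_inequality (μ := μ) hμ hρ0 hρ' hδ hK
  have hlim : Tendsto (fun n : ℕ => Lam ρ (∫ x, F x ∂μ) (∫ x, G x ∂μ) + M * (1 / √(n + 1 : ℕ)))
      atTop (𝓝 (Lam ρ (∫ x, F x ∂μ) (∫ x, G x ∂μ) + M * 0)) := by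
    refine (Tendsto.const_mul M ?_).const_add _
    have h1 : Tendsto (fun n : ℕ => √((n + 1 : ℕ) : ℝ)) atTop atTop :=
      Real.tendsto_sqrt_atTop.comp
        (tendsto_natCast_atTop_atTop.comp (tendsto_add_atTop_nat 1))
    simp only [one_div]
    exact h1.inv_tendsto_atTop
  rw [mul_zero, add_zero] at hlim
  refine ge_of_tendsto' hlim fun n => ?_
  have hn : (0 : ℝ) < √(n + 1 : ℕ) := Real.sqrt_pos.2 (by positivity)
  have hn1 : (1 : ℝ) ≤ √(n + 1 : ℕ) :=
    Real.one_le_sqrt.2 (by push_cast; linarith [n.cast_nonneg (α := ℝ)])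
  -- With r = 1/√(n+1) and n + 1 increments, the total scale is 1 and the total error is M/√(n+1).
  have := h (1 / √(n + 1 : ℕ)) ⟨by positivity, (div_le_one hn).2 hn1⟩ (n + 1) F G D D' hF hG hFm hGm
  rw [mul_one_div_cancel hn.ne'] at this
  simp only [one_smul] at this
  refine this.trans (le_of_eq ?_)
  have hsq : ((n + 1 : ℕ) : ℝ) = √(n + 1 : ℕ) ^ 2 := (Real.sq_sqrt (by positivity)).symm
  congr 1
  nth_rewrite 1 [hsq]
  field_simp

end SmoothInequality

end Borell

namespace Borell

/-! ### From smooth to measurable functions. -/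

section Approximation

open Set Filter Topology

variable {E : Type*} [NormedAddCommGroup E]

section

variable [NormedSpace ℝ E]

lemma HasQuadraticRemainder.mono {K K' : ℝ} {F : E → ℝ} {D : E → E →L[ℝ] ℝ}
    (hF : HasQuadraticRemainder K F D) (h : K ≤ K') : HasQuadraticRemainder K' F D :=
  ⟨hF.continuous, hF.continuous_deriv, fun x => (hF.norm_deriv_le x).trans h,
    fun x u => (hF.remainder_le x u).trans (by gcongr)⟩

lemma HasQuadraticRemainder.affine {K : ℝ} {F : E → ℝ} {D : E → E →L[ℝ] ℝ}
    (hF : HasQuadraticRemainder K F D) (a b : ℝ) :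
    HasQuadraticRemainder (|a| * K) (fun x => a * F x + b) (fun x => a • D x) := by
  refine ⟨(hF.continuous.const_mul a).add continuous_const, hF.continuous_deriv.const_smul a,
    fun x => ?_, fun x u => ?_⟩
  · rw [norm_smul, Real.norm_eq_abs]
    gcongr
    exact hF.norm_deriv_le x
  · have : a * F (x + u) + b - (a * F x + b) - (a • D x) u =
        a * (F (x + u) - F x - D x u) := by
      rw [smul_apply, smul_eq_mul]; ring
    rw [this, abs_mul, mul_assoc]
    gcongr
    exact hF.remainder_le x u

/-- The derivative is C¹ with compact support, hence bounded and Lipschitz; the mean value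
inequality on the ball of radius ‖h‖ gives the quadratic remainder. -/
lemma exists_hasQuadraticRemainder {F : E → ℝ} (hF : ContDiff ℝ 2 F) (hc : HasCompactSupport F) :
    ∃ K, 0 ≤ K ∧ HasQuadraticRemainder K F (fderiv ℝ F) := by
  have hD : ContDiff ℝ 1 (fderiv ℝ F) := hF.fderiv_right (by norm_num)
  have hcD : HasCompactSupport (fderiv ℝ F) := hc.fderiv ℝ
  obtain ⟨C, hC⟩ := hcD.exists_bound_of_continuous hD.continuous
  obtain ⟨K, hK⟩ := hD.lipschitzWith_of_hasCompactSupport hcD (by norm_num)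
  refine ⟨max C K, le_max_of_le_right K.coe_nonneg, hF.continuous, hD.continuous,
    fun x => (hC x).trans (le_max_left _ _), fun x h => ?_⟩
  have hb := (convex_closedBall x ‖h‖).norm_image_sub_le_of_norm_fderiv_le' (𝕜 := ℝ) (f := F)
    (φ := fderiv ℝ F x) (C := K * ‖h‖) (x := x) (y := x + h)
    (fun z _ => hF.differentiable (by norm_num) z)
    (fun z hz => by
      have := hK.dist_le_mul z x
      rw [dist_eq_norm] at this
      refine this.trans ?_
      gcongr
      exact hz) (by simp) (by simp)
  rw [add_sub_cancel_left, mul_assoc, ← pow_two] at hb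
  refine hb.trans ?_
  gcongr
  exact le_max_right _ _

end

variable [InnerProductSpace ℝ E] [FiniteDimensional ℝ E] [MeasurableSpace E] [BorelSpace E]

/-- Approximate in L¹ by a compactly supported continuous function, clamp it to [0,1], smooth it
uniformly, and contract affinely into the open unit interval. -/
lemma exists_smooth_approx {ν : Measure E} [IsProbabilityMeasure ν] {f : E → ℝ}
    (hf : AEMeasurable f ν) (hfm : ∀ x, f x ∈ Icc (0 : ℝ) 1) {ε : ℝ} (hε : 0 < ε) :
    ∃ δ K, 0 < δ ∧ 0 ≤ K ∧ ∃ (F : E → ℝ) (D : E → E →L[ℝ] ℝ), HasQuadraticRemainder K F D ∧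
      (∀ x, F x ∈ Icc δ (1 - δ)) ∧ ∫ x, |f x - F x| ∂ν ≤ ε := by
  set η := min 1 (ε / 12) with hη
  have hη0 : 0 < η := by positivity
  have hη1 : η ≤ 1 := min_le_left _ _
  have hηε : 12 * η ≤ ε := by linarith [min_le_right 1 (ε / 12)]
  have hfi : Integrable f ν := Integrable.of_bound hf.aestronglyMeasurable 1
    (ae_of_all _ fun x => abs_le.2 ⟨by linarith [(hfm x).1], (hfm x).2⟩)
  obtain ⟨g, hgc, hgd, hgcont, hgi⟩ := hfi.exists_hasCompactSupport_integral_sub_le hη0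
  set h : E → ℝ := fun x => max 0 (min (g x) 1) with hh
  have hhcont : Continuous h := by fun_prop
  have hhc : HasCompactSupport h := hgc.comp_left (g := fun t : ℝ => max 0 (min t 1)) (by simp)
  have hhm : ∀ x, h x ∈ Icc (0 : ℝ) 1 := fun x =>
    ⟨le_max_left _ _, max_le zero_le_one (min_le_right _ _)⟩
  have hfh : ∀ x, |f x - h x| ≤ |f x - g x| := by
    intro x
    have e : f x = max 0 (min (f x) 1) := by rw [min_eq_left (hfm x).2, max_eq_right (hfm x).1]
    conv_lhs => rw [e]
    refine (abs_max_sub_max_le_max _ _ _ _).trans ?_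
    rw [sub_self, abs_zero, max_eq_right (abs_nonneg _)]
    refine (abs_min_sub_min_le_max _ _ _ _).trans ?_
    rw [sub_self, abs_zero, max_eq_left (abs_nonneg _)]
  obtain ⟨s, hs, hsd, hss⟩ := hhcont.exists_contDiff_approx 2 (ε := fun _ => η) continuous_const
    (fun _ => hη0)
  have hsd' : ∀ x, |s x - h x| < η := hsd
  have hsc : HasCompactSupport s := hhc.mono hss
  obtain ⟨K, hK, hq⟩ := exists_hasQuadraticRemainder hs hsc
  have hpos : 0 < 1 + 4 * η := by linarith
  -- The map s ↦ (s + 2η)/(1 + 4η) sends (-η, 1 + η) into [δ, 1-δ] for δ = η/(1 + 4η), and moves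
  -- points by at most 10η. With η from smoothing and η from the L¹ step, the total is 12η ≤ ε.
  refine ⟨η / (1 + 4 * η), |(1 + 4 * η)⁻¹| * K, by positivity, by positivity, _, _,
    hq.affine (1 + 4 * η)⁻¹ (2 * η * (1 + 4 * η)⁻¹), fun x => ?_, ?_⟩
  · have h1 := abs_lt.1 (hsd' x)
    have h2 := hhm x
    have e1 : (1 + 4 * η)⁻¹ * s x + 2 * η * (1 + 4 * η)⁻¹ = (s x + 2 * η) / (1 + 4 * η) := by
      field_simp
    have e2 : 1 - η / (1 + 4 * η) = (1 + 3 * η) / (1 + 4 * η) := by field_simp; ring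
    rw [e1, e2]
    constructor
    · exact div_le_div_of_nonneg_right (by linarith [h2.1]) hpos.le
    · exact div_le_div_of_nonneg_right (by linarith [h2.2]) hpos.le
  · have hF : ∀ x, |f x - ((1 + 4 * η)⁻¹ * s x + 2 * η * (1 + 4 * η)⁻¹)| ≤
        |f x - g x| + 11 * η := by
      intro x
      have h1 := abs_lt.1 (hsd' x)
      have h2 := hhm x
      have h3 : |s x - ((1 + 4 * η)⁻¹ * s x + 2 * η * (1 + 4 * η)⁻¹)| ≤ 10 * η := by
        have : s x - ((1 + 4 * η)⁻¹ * s x + 2 * η * (1 + 4 * η)⁻¹) =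
            (4 * η * s x - 2 * η) / (1 + 4 * η) := by field_simp; ring
        rw [this, abs_div, abs_of_pos hpos]
        refine (div_le_self (abs_nonneg _) (by linarith)).trans ?_
        rw [abs_le]
        constructor <;> nlinarith [h2.1, h2.2]
      calc |f x - ((1 + 4 * η)⁻¹ * s x + 2 * η * (1 + 4 * η)⁻¹)|
          = |(f x - h x) - (s x - h x)
            + (s x - ((1 + 4 * η)⁻¹ * s x + 2 * η * (1 + 4 * η)⁻¹))| := by
            ring_nf
        _ ≤ |(f x - h x) - (s x - h x)| +
            |s x - ((1 + 4 * η)⁻¹ * s x + 2 * η * (1 + 4 * η)⁻¹)| := abs_add_le _ _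
        _ ≤ |f x - h x| + |s x - h x| + 10 * η := by gcongr; exact abs_sub _ _
        _ ≤ |f x - g x| + 11 * η := by linarith [hfh x, hsd' x]
    have hi : Integrable (fun x => |f x - g x|) ν := (hfi.sub hgi).abs
    refine (integral_mono_of_nonneg (ae_of_all _ fun x => abs_nonneg _)
      (hi.add (integrable_const (11 * η))) (ae_of_all _ hF)).trans ?_
    rw [integral_add' hi (integrable_const _)]
    simp only [integral_const, probReal_univ, one_smul]
    have : ∫ x, |f x - g x| ∂ν ≤ η := hgd
    linarith

lemma integrable_Lam_comp {Ω : Type*} [MeasurableSpace Ω] {P : Measure Ω} [IsFiniteMeasure P]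
    {ρ : ℝ} (hρ : -1 < ρ) (hρ' : ρ < 1) {X Y : Ω → ℝ} (hX : AEMeasurable X P)
    (hY : AEMeasurable Y P) : Integrable (fun ω => Lam ρ (X ω) (Y ω)) P :=
  Integrable.of_bound ((continuous_Lam hρ hρ').measurable.comp_aemeasurable
    (hX.prodMk hY)).aestronglyMeasurable 1 (ae_of_all _ fun _ => abs_Lam_le_one _ _)

/-- The functional form of Borell's inequality for nonnegative correlation. -/
theorem integral_Lam_le {μ : Measure E} [IsGaussian μ] (hμ : μ[id] = 0) {ρ : ℝ} (hρ0 : 0 ≤ ρ)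
    (hρ' : ρ < 1) {f g : E → ℝ} (hf : AEMeasurable f μ) (hg : AEMeasurable g μ)
    (hfm : ∀ x, f x ∈ Icc (0 : ℝ) 1) (hgm : ∀ x, g x ∈ Icc (0 : ℝ) 1) :
    ∫ p, Lam ρ (f p.1) (g p.2) ∂(correlatedLaw μ ρ) ≤ Lam ρ (∫ x, f x ∂μ) (∫ x, g x ∂μ) := by
  have hρ : -1 < ρ := by linarith
  have hfst := measurePreserving_fst_correlatedLaw μ ρ
  have hsnd := measurePreserving_snd_correlatedLaw hμ hρ hρ'
  have hInt : ∀ {f : E → ℝ}, AEMeasurable f μ → (∀ x, f x ∈ Icc (0 : ℝ) 1) → Integrable f μ :=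
    fun hf hm => Integrable.of_bound hf.aestronglyMeasurable 1
      (ae_of_all _ fun x => abs_le.2 ⟨by linarith [(hm x).1], (hm x).2⟩)
  refine le_of_forall_pos_le_add fun ε hε => ?_
  obtain ⟨δ, K, hδ, hK, F, D, hF, hFm, hFd⟩ :=
    exists_smooth_approx hf hfm (ε := ε / 4) (by linarith)
  obtain ⟨δ', K', hδ', hK', G, D', hG, hGm, hGd⟩ :=
    exists_smooth_approx hg hgm (ε := ε / 4) (by linarith)
  have hFi : Integrable F μ := integrable_comp_of_bounded hF.continuous
    fun x => abs_le_one_of_mem hδ (hFm x)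
  have hGi : Integrable G μ := integrable_comp_of_bounded hG.continuous
    fun x => abs_le_one_of_mem hδ' (hGm x)
  -- Both functions must share one δ and one K. Of the total error ε, each function contributes ε/4
  -- on either side, by the Lipschitz bound.
  have key := smooth_inequality hμ hρ0 hρ' (lt_min hδ hδ') (le_max_of_le_left hK)
    (hF.mono (le_max_left K K')) (hG.mono (le_max_right K K'))
    (fun x => ⟨(min_le_left _ _).trans (hFm x).1, (hFm x).2.trans (by
      linarith [min_le_left δ δ'])⟩)
    (fun x => ⟨(min_le_right _ _).trans (hGm x).1, (hGm x).2.trans (by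
      linarith [min_le_right δ δ'])⟩)
  have hfF : Integrable (fun x => |f x - F x|) μ := ((hInt hf hfm).sub hFi).abs
  have hgG : Integrable (fun x => |g x - G x|) μ := ((hInt hg hgm).sub hGi).abs
  have i1 : Integrable (fun p : E × E => Lam ρ (f p.1) (g p.2)) (correlatedLaw μ ρ) :=
    integrable_Lam_comp hρ hρ' (hf.comp_quasiMeasurePreserving hfst.quasiMeasurePreserving)
      (hg.comp_quasiMeasurePreserving hsnd.quasiMeasurePreserving)
  have i2 : Integrable (fun p : E × E => Lam ρ (F p.1) (G p.2)) (correlatedLaw μ ρ) :=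
    integrable_Lam_comp hρ hρ' (hF.continuous.comp continuous_fst).aemeasurable
      (hG.continuous.comp continuous_snd).aemeasurable
  have i3 : Integrable (fun p : E × E => |f p.1 - F p.1|) (correlatedLaw μ ρ) :=
    hfst.integrable_comp_of_integrable hfF
  have i4 : Integrable (fun p : E × E => |g p.2 - G p.2|) (correlatedLaw μ ρ) :=
    hsnd.integrable_comp_of_integrable hgG
  have h1 : ∫ p, Lam ρ (f p.1) (g p.2) ∂(correlatedLaw μ ρ) ≤
      ∫ p, Lam ρ (F p.1) (G p.2) ∂(correlatedLaw μ ρ) + ε / 4 + ε / 4 := by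
    have hpt : ∀ p : E × E, Lam ρ (f p.1) (g p.2) ≤
        Lam ρ (F p.1) (G p.2) + (|f p.1 - F p.1| + |g p.2 - G p.2|) := fun p => by
      linarith [(abs_le.1 (abs_Lam_sub_le hρ hρ' (f p.1) (g p.2) (F p.1) (G p.2))).2]
    have := integral_mono i1 (i2.add (i3.add i4)) hpt
    rw [integral_add' i2 (i3.add i4), integral_add' i3 i4,
      integral_comp_fst_correlatedLaw (f := fun x => |f x - F x|) hfF.aestronglyMeasurable,
      integral_comp_snd_correlatedLaw hμ hρ hρ' (f := fun x => |g x - G x|)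
        hgG.aestronglyMeasurable] at this
    linarith
  have hdist : ∀ {f F : E → ℝ}, Integrable f μ → Integrable F μ → ∫ x, |f x - F x| ∂μ ≤ ε / 4 →
      |∫ x, F x ∂μ - ∫ x, f x ∂μ| ≤ ε / 4 := fun hf hF h => by
    rw [abs_sub_comm, ← integral_sub hf hF]
    exact abs_integral_le_integral_abs.trans h
  have h2 := (abs_le.1 (abs_Lam_sub_le hρ hρ' (∫ x, F x ∂μ) (∫ x, G x ∂μ) (∫ x, f x ∂μ)
    (∫ x, g x ∂μ))).2
  have h3 := hdist (hInt hf hfm) hFi hFd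
  have h4 := hdist (hInt hg hgm) hGi hGd
  linarith

end Approximation

end Borell

namespace Borell

/-! ### Sheppard's formula via polar coordinates. -/

section Quadrant

open Set Filter Topology

/-- The planar Gaussian density is radial, so the measure of a cone factors into a radial integral
and an angular length. -/
lemma gaussian_prod_polar {S : Set (ℝ × ℝ)} (hS : MeasurableSet S) {T : Set ℝ}
    (hT : MeasurableSet T) (hST : ∀ r > 0, ∀ θ ∈ Ioo (-Real.pi) Real.pi,
      ((r * Real.cos θ, r * Real.sin θ) ∈ S ↔ θ ∈ T)) :
    ((gaussianReal 0 1).prod (gaussianReal 0 1)) S =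
      (∫⁻ r in Ioi (0 : ℝ), ENNReal.ofReal (r * ((2 * Real.pi)⁻¹ * Real.exp (-r ^ 2 / 2)))) *
        volume (T ∩ Ioo (-Real.pi) Real.pi) := by
  have hdens : ∀ x y : ℝ, gaussianPDF 0 1 x * gaussianPDF 0 1 y =
      ENNReal.ofReal ((2 * Real.pi)⁻¹ * Real.exp (-(x ^ 2 + y ^ 2) / 2)) := by
    intro x y
    rw [gaussianPDF, gaussianPDF, ← ENNReal.ofReal_mul (gaussianPDFReal_nonneg _ _ _)]
    congr 1
    change phi x * phi y = _
    rw [phi_eq, phi_eq, mul_mul_mul_comm, ← Real.exp_add, ← mul_inv,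
      Real.mul_self_sqrt (by positivity)]
    ring_nf
  rw [gaussianReal_of_var_ne_zero _ one_ne_zero,
    prod_withDensity (measurable_gaussianPDF 0 1) (measurable_gaussianPDF 0 1),
    withDensity_apply _ hS, ← lintegral_indicator hS, ← Measure.volume_eq_prod,
    ← lintegral_comp_polarCoord_symm, polarCoord_target]
  have hpt : ∀ p ∈ Ioi (0 : ℝ) ×ˢ Ioo (-Real.pi) Real.pi,
      ENNReal.ofReal p.1 • S.indicator (fun z => gaussianPDF 0 1 z.1 * gaussianPDF 0 1 z.2)
        (polarCoord.symm p) =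
      ENNReal.ofReal (p.1 * ((2 * Real.pi)⁻¹ * Real.exp (-p.1 ^ 2 / 2))) *
        T.indicator 1 p.2 := by
    rintro ⟨r, θ⟩ ⟨hr, hθ⟩
    have hr' : 0 < r := hr
    have h := hST r hr θ hθ
    rw [polarCoord_symm_apply]
    by_cases hm : θ ∈ T
    · rw [indicator_of_mem (h.2 hm), indicator_of_mem hm, hdens, smul_eq_mul,
        ← ENNReal.ofReal_mul hr'.le, Pi.one_apply, mul_one]
      have : (r * Real.cos θ) ^ 2 + (r * Real.sin θ) ^ 2 = r ^ 2 := by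
        have := Real.sin_sq_add_cos_sq θ
        linear_combination r ^ 2 * this
      rw [this]
    · rw [indicator_of_notMem (fun h' => hm (h.1 h')), indicator_of_notMem hm, smul_zero, mul_zero]
  rw [setLIntegral_congr_fun (measurableSet_Ioi.prod measurableSet_Ioo) hpt,
    Measure.volume_eq_prod, ← Measure.prod_restrict,
    lintegral_prod_mul
      (f := fun r => ENNReal.ofReal (r * ((2 * Real.pi)⁻¹ * Real.exp (-r ^ 2 / 2))))
      (g := T.indicator 1) (by fun_prop) ((measurable_one.indicator hT).aemeasurable),
    lintegral_indicator_one hT, Measure.restrict_apply hT]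

lemma gaussian_prod_real_polar {S : Set (ℝ × ℝ)} (hS : MeasurableSet S) {a b : ℝ} (hab : a ≤ b)
    (ha : -Real.pi < a) (hb : b < Real.pi) (hST : ∀ r > 0, ∀ θ ∈ Ioo (-Real.pi) Real.pi,
      ((r * Real.cos θ, r * Real.sin θ) ∈ S ↔ θ ∈ Icc a b)) :
    ((gaussianReal 0 1).prod (gaussianReal 0 1)).real S = (b - a) / (2 * Real.pi) := by
  have hpi := Real.pi_pos
  -- The whole plane has measure 1, which fixes the radial factor as 1/(2π) without computing it.
  have h1 := gaussian_prod_polar MeasurableSet.univ MeasurableSet.univ (fun r _ θ _ => by simp)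
  have h2 := gaussian_prod_polar hS measurableSet_Icc hST
  set c := ∫⁻ r in Ioi (0 : ℝ), ENNReal.ofReal (r * ((2 * Real.pi)⁻¹ * Real.exp (-r ^ 2 / 2)))
  rw [univ_inter, Real.volume_Ioo, measure_univ] at h1
  rw [inter_eq_left.2 (Icc_subset_Ioo ha hb), Real.volume_Icc] at h2
  have h1' := congrArg ENNReal.toReal h1
  rw [ENNReal.toReal_mul, ENNReal.toReal_ofReal (by linarith), ENNReal.toReal_one] at h1'
  rw [measureReal_def, h2, ENNReal.toReal_mul, ENNReal.toReal_ofReal (by linarith),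
    eq_div_iff (by positivity)]
  linear_combination (a - b) * h1'

lemma Phi_zero : Phi 0 = 1 / 2 := by
  have h1 := (measurePreserving_neg_of_centered
    integral_id_gaussianReal_zero_one).measureReal_preimage
    (measurableSet_Iic (a := (0 : ℝ))).nullMeasurableSet
  have h2 : (fun x : ℝ => -x) ⁻¹' Iic 0 = Ici 0 := by ext x; simp
  have h3 : (gaussianReal 0 1).real (Ici 0) = (gaussianReal 0 1).real (Iic 0)ᶜ := by
    rw [compl_Iic]; exact measureReal_congr Ioi_ae_eq_Ici.symm
  rw [h2, h3, probReal_compl_eq_one_sub measurableSet_Iic] at h1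
  rw [Phi_eq_real]
  linarith

/-- Sheppard's formula for the orthant probability of a correlated Gaussian pair. -/
theorem Lam_half_half {ρ : ℝ} (hρ : -1 < ρ) (hρ' : ρ < 1) :
    Lam ρ (1 / 2) (1 / 2) = 1 / 2 - 1 / (2 * Real.pi) * Real.arccos ρ := by
  have hpi := Real.pi_pos
  set θ₀ := Real.arccos ρ with hθ₀
  have hcos : Real.cos θ₀ = ρ := Real.cos_arccos hρ.le hρ'.le
  have hsin : Real.sin θ₀ = √(1 - ρ ^ 2) := Real.sin_arccos ρ
  have hθpos : 0 < θ₀ := Real.arccos_pos.2 hρ'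
  have hθlt : θ₀ < Real.pi := (Real.arccos_le_pi ρ).lt_of_ne fun h => by
    rw [hθ₀, h, Real.cos_pi] at hcos; linarith
  have hm : MeasurableSet {p : ℝ × ℝ | 0 ≤ p.1 ∧ 0 ≤ ρ * p.1 + √(1 - ρ ^ 2) * p.2} := by
    have m1 : MeasurableSet {p : ℝ × ℝ | 0 ≤ p.1} := measurableSet_le (by fun_prop) (by fun_prop)
    have m2 : MeasurableSet {p : ℝ × ℝ | 0 ≤ ρ * p.1 + √(1 - ρ ^ 2) * p.2} :=
      measurableSet_le (by fun_prop) (by fun_prop)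
    exact m1.inter m2
  have hneg := measurePreserving_neg_of_centered integral_id_gaussianReal_zero_one
  -- Reflecting through the origin replaces the lower quadrant by the upper one, whose wedge of
  -- angles avoids the cut at ±π.
  have h1 : Lam ρ (1 / 2) (1 / 2) = ((gaussianReal 0 1).prod (gaussianReal 0 1)).real
      {p : ℝ × ℝ | 0 ≤ p.1 ∧ 0 ≤ ρ * p.1 + √(1 - ρ ^ 2) * p.2} := by
    rw [← Phi_zero, Lam_eq_real_prod, lowerTail_Phi, ← (measurePreserving_correlate
      (gaussianReal 0 1) ρ).measureReal_preimage
      (measurableSet_Iic.prod measurableSet_Iic).nullMeasurableSet,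
      ← (hneg.prod hneg).measureReal_preimage hm.nullMeasurableSet]
    congr 1
    ext p
    simp only [mem_preimage, correlate_apply, mem_prod, mem_Iic, Prod.map, mem_ofPred_eq,
      smul_eq_mul]
    constructor <;> rintro ⟨u, v⟩ <;> constructor <;> linarith
  rw [h1, gaussian_prod_real_polar hm (a := θ₀ - Real.pi / 2) (b := Real.pi / 2) (by linarith)
    (by linarith) (by linarith)]
  · field_simp; ring
  · intro r hr θ hθ
    -- The two constraints become cos θ ≥ 0 and cos(θ - θ₀) ≥ 0, a wedge of opening π - θ₀.
    have e : ρ * (r * Real.cos θ) + √(1 - ρ ^ 2) * (r * Real.sin θ) = r * Real.cos (θ - θ₀) := by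
      rw [Real.cos_sub, hcos, hsin]; ring
    simp only [mem_ofPred_eq, e, mem_Icc, mul_nonneg_iff_of_pos_left hr]
    constructor
    · rintro ⟨u, v⟩
      have hle : θ ≤ Real.pi / 2 := by
        by_contra! h
        exact absurd u (Real.cos_neg_of_pi_div_two_lt_of_lt h (by linarith [hθ.2])).not_ge
      have hge : -(Real.pi / 2) ≤ θ := by
        by_contra! h
        have := Real.cos_neg_of_pi_div_two_lt_of_lt (x := -θ) (by linarith) (by linarith [hθ.1])
        rw [Real.cos_neg] at this
        exact absurd u this.not_ge
      refine ⟨?_, hle⟩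
      by_contra! h
      have := Real.cos_neg_of_pi_div_two_lt_of_lt (x := -(θ - θ₀)) (by linarith) (by linarith)
      rw [Real.cos_neg] at this
      exact absurd v this.not_ge
    · rintro ⟨u, v⟩
      exact ⟨Real.cos_nonneg_of_neg_pi_div_two_le_of_le (by linarith) v,
        Real.cos_nonneg_of_neg_pi_div_two_le_of_le (by linarith) (by linarith)⟩

end Quadrant

end Borell

namespace Borell

/-! ### Parallel halfspaces reduce to one dimension. -/

section Halfspaces

open Set Filter Topology

/-- Forming a correlated pair commutes with linear maps; applied to a coordinate, it reduces
halfspaces to half-lines. -/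
lemma measurePreserving_prodMap_correlatedLaw {E F : Type*} [NormedAddCommGroup E] [NormedSpace ℝ E]
    [MeasurableSpace E] [BorelSpace E] [SecondCountableTopology E] [NormedAddCommGroup F]
    [NormedSpace ℝ F] [MeasurableSpace F] [BorelSpace F] [SecondCountableTopology F]
    {μ : Measure E} {ν : Measure F} [SFinite μ] [SFinite ν] {L : E →L[ℝ] F}
    (hL : MeasurePreserving L μ ν) (ρ : ℝ) :
    MeasurePreserving (Prod.map L L) (correlatedLaw μ ρ) (correlatedLaw ν ρ) := by
  have h := (measurePreserving_correlate ν ρ).comp (hL.prod hL)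
  refine ⟨by fun_prop, ?_⟩
  rw [← h.map_eq, correlatedLaw_eq_map, Measure.map_map (by fun_prop) (by fun_prop)]
  congr 1
  ext p <;> simp [correlate_apply]

variable {d : ℕ} {v : Space d}

/-- The coordinate in the direction of `v`. -/
noncomputable def coordinate (v : Space d) : Space d →L[ℝ] ℝ := innerSL ℝ (‖v‖⁻¹ • v)

lemma inner_eq_norm_mul_coordinate (hv : v ≠ 0) (x : Space d) :
    inner ℝ v x = ‖v‖ * coordinate v x := by
  rw [coordinate, innerSL_apply_apply, real_inner_smul_left, ← mul_assoc,
    mul_inv_cancel₀ (norm_ne_zero_iff.2 hv), one_mul]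

lemma integral_id_gaussian (d : ℕ) : (gaussian d)[id] = 0 := integral_id_stdGaussian

lemma measurePreserving_coordinate (hv : v ≠ 0) :
    MeasurePreserving (coordinate v) (gaussian d) (gaussianReal 0 1) := by
  refine ⟨by fun_prop, ?_⟩
  have hn : ‖coordinate v‖ = 1 := by
    rw [coordinate, innerSL_apply_norm, norm_smul, norm_inv, norm_norm,
      inv_mul_cancel₀ (norm_ne_zero_iff.2 hv)]
  rw [IsGaussian.map_eq_gaussianReal, integral_strongDual_stdGaussian, variance_dual_stdGaussian,
    hn]
  simp

lemma IsHalfspace.exists_isLowerSet {H : Set (Space d)} (hv : v ≠ 0) (hH : IsHalfspace v H) :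
    ∃ S : Set ℝ, IsLowerSet S ∧ H = coordinate v ⁻¹' S := by
  obtain ⟨a, rfl | rfl⟩ := hH
  · refine ⟨{t | ((‖v‖ * t : ℝ) : EReal) ≤ a}, fun s t hts hs => ?_, ?_⟩
    · exact (EReal.coe_le_coe_iff.2 (mul_le_mul_of_nonneg_left hts (norm_nonneg v))).trans hs
    · ext x; simp only [mem_ofPred_eq, mem_preimage, inner_eq_norm_mul_coordinate hv]
  · refine ⟨{t | ((‖v‖ * t : ℝ) : EReal) < a}, fun s t hts hs => ?_, ?_⟩
    · exact (EReal.coe_le_coe_iff.2 (mul_le_mul_of_nonneg_left hts (norm_nonneg v))).trans_lt hs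
    · ext x; simp only [mem_ofPred_eq, mem_preimage, inner_eq_norm_mul_coordinate hv]

lemma exists_isHalfspace_real_eq (hv : v ≠ 0) {α : ℝ} (hα : α ∈ Icc (0 : ℝ) 1) :
    ∃ H, IsHalfspace v H ∧ (gaussian d).real H = α := by
  refine ⟨coordinate v ⁻¹' lowerTail α, ?_, ?_⟩
  · rcases hα.1.eq_or_lt with rfl | h0
    · exact ⟨⊥, Or.inl (by simp [lowerTail_of_nonpos le_rfl])⟩
    rcases hα.2.eq_or_lt with rfl | h1
    · exact ⟨⊤, Or.inl (by simp [lowerTail_of_one_le le_rfl])⟩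
    obtain ⟨t, rfl⟩ := exists_Phi_eq ⟨h0, h1⟩
    refine ⟨((‖v‖ * t : ℝ) : EReal), Or.inl ?_⟩
    ext x
    rw [lowerTail_Phi, mem_preimage, mem_Iic, mem_ofPred_eq, EReal.coe_le_coe_iff,
      inner_eq_norm_mul_coordinate hv, mul_le_mul_iff_right₀ (norm_pos_iff.2 hv)]
  · rw [(measurePreserving_coordinate hv).measureReal_preimage
      (isLowerSet_lowerTail α).measurableSet_real.nullMeasurableSet, real_lowerTail_of_mem hα]

variable {Ω : Type*} [MeasurableSpace Ω] {P : Measure Ω} {ρ : ℝ} {z z' : Ω → Space d}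

lemma IsCorrelatedGaussianPair.real_halfspaces (hz : IsCorrelatedGaussianPair ρ z z' P)
    (hρ : -1 < ρ) (hρ' : ρ < 1) {H H' : Set (Space d)} (h : AreParallelHalfspaces H H') :
    P.real {ω | z ω ∈ H ∧ z' ω ∈ H'} =
      Lam ρ ((gaussian d).real H) ((gaussian d).real H') := by
  obtain ⟨v, hv, h1, h2⟩ := h
  obtain ⟨S, hS, rfl⟩ := h1.exists_isLowerSet hv
  obtain ⟨T, hT, rfl⟩ := h2.exists_isLowerSet hv
  have hmp := measurePreserving_coordinate hv
  have hSm := hS.measurableSet_real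
  have hTm := hT.measurableSet_real
  rw [hmp.measureReal_preimage hSm.nullMeasurableSet, hmp.measureReal_preimage
    hTm.nullMeasurableSet, ← real_prod_eq_Lam hρ hρ' hS hT,
    ← (measurePreserving_prodMap_correlatedLaw hmp ρ).measureReal_preimage
      (hSm.prod hTm).nullMeasurableSet]
  exact hz.measureReal_eq
    (p := fun p : Space d × Space d => coordinate v p.1 ∈ S ∧ coordinate v p.2 ∈ T)
    ((measurePreserving_prodMap_correlatedLaw hmp ρ).measurable (hSm.prod hTm))

end Halfspaces

/-! ### Negative correlation, and transfer to random vectors and sets. -/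

section RandomPair

open Set Filter Topology

/-- The functional form of Borell's inequality for nonpositive correlation. -/
theorem le_integral_Lam {E : Type*} [NormedAddCommGroup E] [InnerProductSpace ℝ E]
    [FiniteDimensional ℝ E] [MeasurableSpace E] [BorelSpace E] {μ : Measure E} [IsGaussian μ]
    (hμ : μ[id] = 0) {ρ : ℝ} (hρ : -1 < ρ) (hρ0 : ρ ≤ 0) {f g : E → ℝ} (hf : AEMeasurable f μ)
    (hg : AEMeasurable g μ) (hfm : ∀ x, f x ∈ Icc (0 : ℝ) 1) (hgm : ∀ x, g x ∈ Icc (0 : ℝ) 1) :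
    Lam ρ (∫ x, f x ∂μ) (∫ x, g x ∂μ) ≤ ∫ p, Lam ρ (f p.1) (g p.2) ∂(correlatedLaw μ ρ) := by
  have hρ' : ρ < 1 := by linarith
  have hneg := measurePreserving_neg_of_centered hμ
  have hInt : ∀ {f : E → ℝ}, AEMeasurable f μ → (∀ x, f x ∈ Icc (0 : ℝ) 1) → Integrable f μ :=
    fun hf hm => Integrable.of_bound hf.aestronglyMeasurable 1
      (ae_of_all _ fun x => abs_le.2 ⟨by linarith [(hm x).1], (hm x).2⟩)
  have hfi := hInt hf hfm
  have hgi := hInt hg hgm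
  -- The case -ρ ≥ 0 is applied to f and 1 - g(-·): the reflection restores the correlation ρ, and
  -- the complement matches `Lam_eq_sub_Lam_neg`, where the minus sign reverses the inequality.
  have hg' : AEMeasurable (fun x => 1 - g (-x)) μ :=
    (hg.comp_quasiMeasurePreserving hneg.quasiMeasurePreserving).const_sub 1
  have hmain := integral_Lam_le hμ (ρ := -ρ) (by linarith) (by linarith) hf hg' hfm
    (fun x => ⟨by linarith [(hgm (-x)).2], by linarith [(hgm (-x)).1]⟩)
  have e1 : ∫ x, (1 - g (-x)) ∂μ = 1 - ∫ x, g x ∂μ := by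
    have := hneg.hasLaw.integral_comp (f := fun x => 1 - g x)
      ((integrable_const 1).sub hgi).aestronglyMeasurable
    simp only [Function.comp_def] at this
    rw [this, integral_sub (integrable_const _) hgi]
    simp
  have hfst := measurePreserving_fst_correlatedLaw μ ρ
  have hsnd := measurePreserving_snd_correlatedLaw hμ hρ hρ'
  have hsnd' := measurePreserving_snd_correlatedLaw (ρ := -ρ) hμ (by linarith) (by linarith)
  have hfst' := measurePreserving_fst_correlatedLaw μ (-ρ)
  have hns := measurePreserving_neg_snd_correlatedLaw hμ ρ
  have e2 : ∫ p, Lam (-ρ) (f p.1) (1 - g (-p.2)) ∂(correlatedLaw μ (-ρ)) =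
      ∫ p, Lam (-ρ) (f p.1) (1 - g p.2) ∂(correlatedLaw μ ρ) := by
    have := hns.hasLaw.integral_comp
      (f := fun p : E × E => Lam (-ρ) (f p.1) (1 - g (-p.2)))
      (integrable_Lam_comp (by linarith) (by linarith)
        (hf.comp_quasiMeasurePreserving hfst'.quasiMeasurePreserving)
        (hg'.comp_quasiMeasurePreserving hsnd'.quasiMeasurePreserving)).aestronglyMeasurable
    simpa [Function.comp_def] using this.symm
  have hfm' := integral_mem_Icc hfi hfm
  have hgm' := integral_mem_Icc hgi hgm
  rw [e1, e2] at hmain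
  rw [Lam_eq_sub_Lam_neg hρ hρ' hfm' hgm']
  have e3 : ∀ p : E × E, Lam ρ (f p.1) (g p.2) = f p.1 - Lam (-ρ) (f p.1) (1 - g p.2) :=
    fun p => Lam_eq_sub_Lam_neg hρ hρ' (hfm _) (hgm _)
  have i1 : Integrable (fun p : E × E => f p.1) (correlatedLaw μ ρ) :=
    hfst.integrable_comp_of_integrable hfi
  have i2 : Integrable (fun p : E × E => Lam (-ρ) (f p.1) (1 - g p.2)) (correlatedLaw μ ρ) :=
    integrable_Lam_comp (by linarith) (by linarith)
      (hf.comp_quasiMeasurePreserving hfst.quasiMeasurePreserving)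
      ((hg.comp_quasiMeasurePreserving hsnd.quasiMeasurePreserving).const_sub 1)
  simp_rw [e3]
  rw [integral_sub i1 i2, integral_comp_fst_correlatedLaw hf.aestronglyMeasurable]
  linarith

variable {d : ℕ} {Ω : Type*} [MeasurableSpace Ω] {P : Measure Ω} {ρ : ℝ} {z z' : Ω → Space d}

lemma IsCorrelatedGaussianPair.hasLaw_fst (hz : IsCorrelatedGaussianPair ρ z z' P) :
    HasLaw z (gaussian d) P :=
  (measurePreserving_fst_correlatedLaw (gaussian d) ρ).comp_hasLaw hz

lemma IsCorrelatedGaussianPair.hasLaw_snd (hz : IsCorrelatedGaussianPair ρ z z' P) (hρ : -1 < ρ)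
    (hρ' : ρ < 1) : HasLaw z' (gaussian d) P :=
  (measurePreserving_snd_correlatedLaw (integral_id_gaussian d) hρ hρ').comp_hasLaw hz

lemma aemeasurable_comp_hasLaw {X : Ω → Space d} (hX : HasLaw X (gaussian d) P) {f : Space d → ℝ}
    (hf : AEMeasurable f (gaussian d)) : AEMeasurable (fun ω => f (X ω)) P := by
  rw [← hX.map_eq] at hf
  exact hf.comp_aemeasurable hX.aemeasurable

/-- Integrability and the functional inequalities for a correlated Gaussian pair. -/
theorem IsCorrelatedGaussianPair.functional_inequality [IsProbabilityMeasure P]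
    (hz : IsCorrelatedGaussianPair ρ z z' P) (hρ : -1 < ρ) (hρ' : ρ < 1) {f g : Space d → ℝ}
    (hf : AEMeasurable f (gaussian d)) (hg : AEMeasurable g (gaussian d))
    (hfm : ∀ x, f x ∈ Icc (0 : ℝ) 1) (hgm : ∀ x, g x ∈ Icc (0 : ℝ) 1) :
    Integrable (fun ω => Lam ρ (f (z ω)) (g (z' ω))) P ∧
    (0 < ρ → ∫ ω, Lam ρ (f (z ω)) (g (z' ω)) ∂P ≤
      Lam ρ (∫ ω, f (z ω) ∂P) (∫ ω, g (z' ω) ∂P)) ∧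
    (ρ < 0 → Lam ρ (∫ ω, f (z ω) ∂P) (∫ ω, g (z' ω) ∂P) ≤
      ∫ ω, Lam ρ (f (z ω)) (g (z' ω)) ∂P) := by
  have hz1 := hz.hasLaw_fst
  have hz2 := hz.hasLaw_snd hρ hρ'
  have hfst := measurePreserving_fst_correlatedLaw (gaussian d) ρ
  have hsnd := measurePreserving_snd_correlatedLaw (integral_id_gaussian d) hρ hρ'
  have ef : ∫ ω, f (z ω) ∂P = ∫ x, f x ∂(gaussian d) :=
    hz1.integral_comp hf.aestronglyMeasurable
  have eg : ∫ ω, g (z' ω) ∂P = ∫ x, g x ∂(gaussian d) :=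
    hz2.integral_comp hg.aestronglyMeasurable
  have eL : ∫ ω, Lam ρ (f (z ω)) (g (z' ω)) ∂P =
      ∫ p, Lam ρ (f p.1) (g p.2) ∂(correlatedLaw (gaussian d) ρ) :=
    HasLaw.integral_comp hz (f := fun p : Space d × Space d => Lam ρ (f p.1) (g p.2))
      (integrable_Lam_comp hρ hρ'
        (hf.comp_quasiMeasurePreserving hfst.quasiMeasurePreserving)
        (hg.comp_quasiMeasurePreserving hsnd.quasiMeasurePreserving)).aestronglyMeasurable
  refine ⟨integrable_Lam_comp hρ hρ' (aemeasurable_comp_hasLaw hz1 hf)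
    (aemeasurable_comp_hasLaw hz2 hg), fun h => ?_, fun h => ?_⟩
  · rw [ef, eg, eL]
    exact integral_Lam_le (integral_id_gaussian d) h.le hρ' hf hg hfm hgm
  · rw [ef, eg, eL]
    exact le_integral_Lam (integral_id_gaussian d) hρ h.le hf hg hfm hgm

/-- Borell's inequality for sets. -/
theorem IsCorrelatedGaussianPair.set_inequality [IsProbabilityMeasure P]
    (hz : IsCorrelatedGaussianPair ρ z z' P) (hρ : -1 < ρ) (hρ' : ρ < 1) {A B : Set (Space d)}
    (hA : NullMeasurableSet A (gaussian d)) (hB : NullMeasurableSet B (gaussian d)) :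
    (0 < ρ → P.real {ω | z ω ∈ A ∧ z' ω ∈ B} ≤
      Lam ρ ((gaussian d).real A) ((gaussian d).real B)) ∧
    (ρ < 0 → Lam ρ ((gaussian d).real A) ((gaussian d).real B) ≤
      P.real {ω | z ω ∈ A ∧ z' ω ∈ B}) := by
  have hind : ∀ {A : Set (Space d)}, NullMeasurableSet A (gaussian d) →
      AEMeasurable (A.indicator (1 : Space d → ℝ)) (gaussian d) := fun hA =>
    aemeasurable_one.indicator₀ hA
  have hmem : ∀ (A : Set (Space d)) x, A.indicator (1 : Space d → ℝ) x ∈ Icc (0 : ℝ) 1 :=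
    fun A x => ⟨indicator_nonneg (fun _ _ => zero_le_one) x,
      indicator_le_self' (fun _ _ => zero_le_one) x⟩
  have hreal : ∀ {X : Ω → Space d}, HasLaw X (gaussian d) P → ∀ {A : Set (Space d)},
      NullMeasurableSet A (gaussian d) →
      ∫ ω, A.indicator (1 : Space d → ℝ) (X ω) ∂P = (gaussian d).real A := by
    intro X hX A hA
    have := hX.integral_comp (hind hA).aestronglyMeasurable
    simp only [Function.comp_def] at this
    rw [this, integral_indicator₀ hA]
    simp
  have hz1 := hz.hasLaw_fst
  have hz2 := hz.hasLaw_snd hρ hρ'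
  obtain ⟨hi, h1, h2⟩ := hz.functional_inequality hρ hρ' (hind hA) (hind hB) (hmem A) (hmem B)
  -- On the vertices of the unit square Λ is the product, so it takes indicators to the indicator of
  -- the joint event.
  have hpt : (fun ω => Lam ρ (A.indicator (1 : Space d → ℝ) (z ω))
      (B.indicator (1 : Space d → ℝ) (z' ω))) =
      {ω | z ω ∈ A ∧ z' ω ∈ B}.indicator (1 : Ω → ℝ) := by
    ext ω
    by_cases ha : z ω ∈ A <;> by_cases hb : z' ω ∈ B <;>
      simp [indicator, ha, hb, Lam_one_one, Lam_zero_left, Lam_zero_right]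
  -- The event is the level set at 1 of an almost everywhere measurable function.
  have hnull : NullMeasurableSet {ω | z ω ∈ A ∧ z' ω ∈ B} P := by
    have := hi.aestronglyMeasurable.aemeasurable.nullMeasurable (measurableSet_singleton (1 : ℝ))
    rw [hpt] at this
    convert this using 1
    ext ω
    by_cases h : ω ∈ {ω | z ω ∈ A ∧ z' ω ∈ B} <;> simp [indicator, h]
  have hP : ∫ ω, Lam ρ (A.indicator (1 : Space d → ℝ) (z ω))
      (B.indicator (1 : Space d → ℝ) (z' ω)) ∂P = P.real {ω | z ω ∈ A ∧ z' ω ∈ B} := by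
    rw [hpt, integral_indicator₀ hnull]
    simp
  rw [hP, hreal hz1 hA, hreal hz2 hB] at h1 h2
  exact ⟨h1, h2⟩

end RandomPair

end Borell

/-! ### Assembly of the three statements. -/

theorem mainTheorem3 {d : ℕ} {Ω : Type*} [MeasurableSpace Ω] (P : Measure Ω)
    [IsProbabilityMeasure P] (ρ : ℝ) (hρ : -1 < ρ) (hρ' : ρ < 1)
    (z z' : Ω → Borell.Space d) (hz : Borell.IsCorrelatedGaussianPair ρ z z' P) :
    -- sets
    (∀ α ∈ Set.Icc (0 : ℝ) 1, ∀ β ∈ Set.Icc (0 : ℝ) 1,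
      -- for every direction there are parallel halfspaces of volumes `α`, `β` normal to it
      (∀ v : Borell.Space d, v ≠ 0 → ∃ H H' : Set (Borell.Space d),
        Borell.IsHalfspace v H ∧ Borell.IsHalfspace v H' ∧
        (Borell.gaussian d).real H = α ∧ (Borell.gaussian d).real H' = β) ∧
      -- all parallel halfspaces of volumes `α`, `β` have the value `Λ_ρ(α, β)`
      (∀ H H' : Set (Borell.Space d), Borell.AreParallelHalfspaces H H' →
        (Borell.gaussian d).real H = α → (Borell.gaussian d).real H' = β →
        P.real {ω | z ω ∈ H ∧ z' ω ∈ H'} = Borell.Lam ρ α β) ∧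
      -- and they are optimal
      (∀ A B : Set (Borell.Space d),
        NullMeasurableSet A (Borell.gaussian d) → NullMeasurableSet B (Borell.gaussian d) →
        (Borell.gaussian d).real A = α → (Borell.gaussian d).real B = β →
        (0 < ρ →
          P.real {ω | z ω ∈ A ∧ z' ω ∈ B} ≤ Borell.Lam ρ α β ∧
          ∀ H H' : Set (Borell.Space d), Borell.AreParallelHalfspaces H H' →
            (Borell.gaussian d).real H = α → (Borell.gaussian d).real H' = β →
            P.real {ω | z ω ∈ A ∧ z' ω ∈ B} ≤ P.real {ω | z ω ∈ H ∧ z' ω ∈ H'}) ∧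
        (ρ < 0 →
          Borell.Lam ρ α β ≤ P.real {ω | z ω ∈ A ∧ z' ω ∈ B} ∧
          ∀ H H' : Set (Borell.Space d), Borell.AreParallelHalfspaces H H' →
            (Borell.gaussian d).real H = α → (Borell.gaussian d).real H' = β →
            P.real {ω | z ω ∈ H ∧ z' ω ∈ H'} ≤ P.real {ω | z ω ∈ A ∧ z' ω ∈ B}))) ∧
    -- volumes one half
    Borell.Lam ρ (1 / 2) (1 / 2) = 1 / 2 - 1 / (2 * Real.pi) * Real.arccos ρ ∧
    (0 < ρ → ∀ A B : Set (Borell.Space d),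
      NullMeasurableSet A (Borell.gaussian d) → NullMeasurableSet B (Borell.gaussian d) →
      (Borell.gaussian d).real A = 1 / 2 → (Borell.gaussian d).real B = 1 / 2 →
      P.real {ω | z ω ∈ A ∧ z' ω ∈ B} ≤ 1 / 2 - 1 / (2 * Real.pi) * Real.arccos ρ) ∧
    -- functions
    (∀ f g : Borell.Space d → ℝ,
      AEMeasurable f (Borell.gaussian d) → AEMeasurable g (Borell.gaussian d) →
      (∀ x, f x ∈ Set.Icc (0 : ℝ) 1) → (∀ x, g x ∈ Set.Icc (0 : ℝ) 1) →
      Integrable (fun ω => Borell.Lam ρ (f (z ω)) (g (z' ω))) P ∧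
      (0 < ρ →
        ∫ ω, Borell.Lam ρ (f (z ω)) (g (z' ω)) ∂P ≤
          Borell.Lam ρ (∫ ω, f (z ω) ∂P) (∫ ω, g (z' ω) ∂P)) ∧
      (ρ < 0 →
        Borell.Lam ρ (∫ ω, f (z ω) ∂P) (∫ ω, g (z' ω) ∂P) ≤
          ∫ ω, Borell.Lam ρ (f (z ω)) (g (z' ω)) ∂P)) := by
  refine ⟨fun α hα β hβ => ⟨fun v hv => ?_, fun H H' hH h1 h2 => ?_, fun A B hA hB h1 h2 => ?_⟩,
    Borell.Lam_half_half hρ hρ', fun h0 A B hA hB h1 h2 => ?_, fun f g hf hg hfm hgm =>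
      hz.functional_inequality hρ hρ' hf hg hfm hgm⟩
  · obtain ⟨H, hH, hHα⟩ := Borell.exists_isHalfspace_real_eq hv hα
    obtain ⟨H', hH', hHβ⟩ := Borell.exists_isHalfspace_real_eq hv hβ
    exact ⟨H, H', hH, hH', hHα, hHβ⟩
  · rw [hz.real_halfspaces hρ hρ' hH, h1, h2]
  · obtain ⟨hpos, hneg⟩ := hz.set_inequality hρ hρ' hA hB
    rw [h1, h2] at hpos hneg
    refine ⟨fun h0 => ⟨hpos h0, fun H H' hH e1 e2 => ?_⟩,
      fun h0 => ⟨hneg h0, fun H H' hH e1 e2 => ?_⟩⟩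
    · rw [hz.real_halfspaces hρ hρ' hH, e1, e2]
      exact hpos h0
    · rw [hz.real_halfspaces hρ hρ' hH, e1, e2]
      exact hneg h0
  · have := (hz.set_inequality hρ hρ' hA hB).1 h0
    rwa [h1, h2, Borell.Lam_half_half hρ hρ'] at this
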